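/- An ultragraph $\mathcal G=(G^0,\mathcal G^1,r,s)$ consists of countable sets $G^0$ (vertices) and $\mathcal G^1$ (edges) and maps $s:\mathcal G^1\to G^0$ and $r:\mathcal G^1\to\mathcal P(G^0)\setminus\{\varnothing\}$. Let $\mathcal G^0\subseteq\mathcal P(G^0)$ (the generalized vertices) be the smallest family of subsets of $G^0$ that contains $\{v\}$ for every $v\in G^0$ and $r(e)$ for every $e\in\mathcal G^1$ and is closed under relative complements, finite unions (including the empty union $\varnothing$) and finite intersections. For a field $K$, the Leavitt path algebra $L_K(\mathcal G)$ is the associative, not necessarily unital, $K$-algebra generated by $\{p_A\mid A\in\mathcal G^0\}\cup\{s_e,s_e^*\mid e\in\mathcal G^1\}$ subject to the relations, for all $A,B\in\mathcal G^0$ and $e,f\in\mathcal G^1$: 1. $p_\varnothing=0$, $p_Ap_B=p_{A\cap B}$ and $p_{A\cup B}=p_A+p_B-p_{A\cap B}$; 2. $p_{\{s(e)\}}s_e=s_e=s_ep_{r(e)}$ and $p_{r(e)}s_e^*=s_e^*=s_e^*p_{\{s(e)\}}$; 3. $s_e^*s_f=\delta_{e,f}\,p_{r(e)}$; 4. $p_{\{v\}}=\sum_{s(e)=v}s_es_e^*$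 for every $v\in G^0$ with $0<|s^{-1}(v)|<\infty$. A cycle based at $v\in G^0$ is a sequence of edges $c=e_1e_2\cdots e_n$ with $n\ge 1$, $s(e_{i+1})\in r(e_i)$ for $1\le i<n$, $v=s(e_1)\in r(e_n)$, and $s(e_i)\ne s(e_j)$ for $i\neq j$; put $r(c):=r(e_n)$ and $s_c:=s_{e_1}\cdots s_{e_n}$. **Theorem.** Let $K$ be a field, $\mathcal G$ an ultragraph and $I$ a two-sided ideal of $L_K(\mathcal G)$. Then $I$ is generated, as a two-sided ideal, by a set of elements of $I$ each of which has the form $$\Bigl(p_A+\sum_{i=1}^{m}k_i\,s_c^{r_i}\Bigr)\Bigl(p_A-\sum_{e\in S}s_es_e^*\Bigr),$$ where $A\in\mathcal G^0$, $v\in A$, $m\ge 0$, $k_1,\dots,k_m\in K$, $r_1,\dots,r_m$ are positive integers, $S$ is a finite (possibly empty) set of edges all of which have source $v$, and, whenever $k_i\ne 0$ for some $i$, $c$ is a cycle based at $v$, it is the only cycle based at $v$, and $A\subseteq r(c)$. (If all $k_i$ are zero, the first factor is $p_A$ and no cycle is needed.) -/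

import Mathlib

/-- An ultragraph with vertex set `V` and edge set `E`: every edge has a source vertex and
a nonempty set of vertices as its range.  Countability of `V` and `E` is
assumed separately, where it is wanted. -/
structure Ultragraph (V : Type*) (E : Type*) where
  source : E → V
  range : E → Set V
  range_nonempty : ∀ e, (range e).Nonempty

namespace Ultragraph

universe u v w

variable {V : Type u} {E : Type v}

/-- The smallest family of subsets of `V` that contains all singletons and all ranges of edges and
is closed under finite unions (the empty one included), intersections and relative complements. -/
inductive IsGenVertex (G : Ultragraph V E) : Set V → Prop
  | empty : IsGenVertex G ∅
  | singleton (v : V) : IsGenVertex G {v}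
  | range (e : E) : IsGenVertex G (G.range e)
  | union {A B : Set V} : IsGenVertex G A → IsGenVertex G B → IsGenVertex G (A ∪ B)
  | inter {A B : Set V} : IsGenVertex G A → IsGenVertex G B → IsGenVertex G (A ∩ B)
  | sdiff {A B : Set V} : IsGenVertex G A → IsGenVertex G B → IsGenVertex G (A \ B)

/-- The generalized vertices of `G`. -/
def GenVertex (G : Ultragraph V E) : Type u := {A : Set V // G.IsGenVertex A}

/-- The symbols `p_A`, `s_e`, `s_e^*`. -/
inductive Gen (G : Ultragraph V E) : Type (max u v)
  | p (A : G.GenVertex) : Gen G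
  | s (e : E) : Gen G
  | sStar (e : E) : Gen G

/-- The free associative, not necessarily unital, `K`-algebra on the symbols
`p_A`, `s_e`, `s_e^*`: the algebra of the free semigroup on them. -/
abbrev FreeAlg (G : Ultragraph V E) (K : Type w) [Field K] : Type (max u v w) :=
  MonoidAlgebra K (FreeSemigroup G.Gen)

section Relations

variable (G : Ultragraph V E) (K : Type w) [Field K]

/-- A symbol as an element of the free algebra. -/
noncomputable def gen (x : G.Gen) : G.FreeAlg K := MonoidAlgebra.single (FreeSemigroup.of x) 1

/-- The symbol `p_A` in the free algebra. -/
noncomputable def freeP (A : Set V) (hA : G.IsGenVertex A) : G.FreeAlg K := G.gen K (.p ⟨A, hA⟩)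

/-- The symbol `s_e` in the free algebra. -/
noncomputable def freeS (e : E) : G.FreeAlg K := G.gen K (.s e)

/-- The symbol `s_e^*` in the free algebra. -/
noncomputable def freeSStar (e : E) : G.FreeAlg K := G.gen K (.sStar e)

/-- The smallest `K`-algebra congruence on the free algebra that contains the defining relations
of the Leavitt path algebra. -/
inductive Rel : G.FreeAlg K → G.FreeAlg K → Prop
  -- congruence closure
  | refl (a) : Rel a a
  | symm {a b} : Rel a b → Rel b a
  | trans {a b c} : Rel a b → Rel b c → Rel a c
  | add {a b c d} : Rel a b → Rel c d → Rel (a + c) (b + d)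
  | mul {a b c d} : Rel a b → Rel c d → Rel (a * c) (b * d)
  | smul (k : K) {a b} : Rel a b → Rel (k • a) (k • b)
  -- `p` is a Boolean representation of the generalized vertices
  | p_empty : Rel (G.freeP K ∅ .empty) 0
  | p_inter {A B} (hA : G.IsGenVertex A) (hB : G.IsGenVertex B) :
      Rel (G.freeP K A hA * G.freeP K B hB) (G.freeP K (A ∩ B) (hA.inter hB))
  | p_union {A B} (hA : G.IsGenVertex A) (hB : G.IsGenVertex B) :
      Rel (G.freeP K (A ∪ B) (hA.union hB))
        (G.freeP K A hA + G.freeP K B hB - G.freeP K (A ∩ B) (hA.inter hB))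
  -- compatibility with source and range
  | source_s (e) :
      Rel (G.freeP K {G.source e} (.singleton _) * G.freeS K e) (G.freeS K e)
  | s_range (e) :
      Rel (G.freeS K e * G.freeP K (G.range e) (.range e)) (G.freeS K e)
  | range_sStar (e) :
      Rel (G.freeP K (G.range e) (.range e) * G.freeSStar K e) (G.freeSStar K e)
  | sStar_source (e) :
      Rel (G.freeSStar K e * G.freeP K {G.source e} (.singleton _)) (G.freeSStar K e)
  -- `s_e^* s_f = δ_{e,f} p_{r(e)}`
  | sStar_s_self (e) :
      Rel (G.freeSStar K e * G.freeS K e) (G.freeP K (G.range e) (.range e))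
  | sStar_s_ne {e f} : e ≠ f → Rel (G.freeSStar K e * G.freeS K f) 0
  -- `p_v = ∑_{s(e) = v} s_e s_e^*` for regular vertices `v`
  | regular (v : V) (hfin : {e | G.source e = v}.Finite) (hne : {e | G.source e = v}.Nonempty) :
      Rel (G.freeP K {v} (.singleton v))
        (∑ e ∈ hfin.toFinset, G.freeS K e * G.freeSStar K e)

/-- `Rel` as a ring congruence. -/
def relCon : RingCon (G.FreeAlg K) where
  r := G.Rel K
  iseqv := ⟨.refl, .symm, .trans⟩
  add' := .add
  mul' := .mul

/-- The Leavitt path algebra `L_K(G)`: the associative, not necessarily unital, `K`-algebra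
generated by the `p_A`, `s_e`, `s_e^*` subject to the relations listed in `Rel`. -/
def LeavittPathAlgebra : Type (max u v w) := (G.relCon K).Quotient

end Relations

namespace LeavittPathAlgebra

variable {G : Ultragraph V E} {K : Type w} [Field K]

noncomputable instance : NonUnitalRing (G.LeavittPathAlgebra K) :=
  inferInstanceAs (NonUnitalRing (G.relCon K).Quotient)

variable (G K) in
/-- The quotient map from the free algebra. -/
noncomputable def mk (a : G.FreeAlg K) : G.LeavittPathAlgebra K := RingCon.toQuotient (c := G.relCon K) a

theorem mk_surjective : Function.Surjective (mk G K) :=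
  fun x => Quotient.inductionOn' x fun a => ⟨a, rfl⟩

theorem mk_add (a b : G.FreeAlg K) : mk G K (a + b) = mk G K a + mk G K b := rfl

theorem mk_mul (a b : G.FreeAlg K) : mk G K (a * b) = mk G K a * mk G K b := rfl

theorem mk_zero : mk G K 0 = 0 := rfl

theorem mk_eq_iff {a b : G.FreeAlg K} : mk G K a = mk G K b ↔ G.Rel K a b :=
  RingCon.eq (G.relCon K)

noncomputable instance : SMul K (G.LeavittPathAlgebra K) :=
  ⟨fun k => Quotient.map' (k • ·) fun _ _ h => Rel.smul k h⟩

theorem mk_smul (k : K) (a : G.FreeAlg K) : mk G K (k • a) = k • mk G K a := rfl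

noncomputable instance : Module K (G.LeavittPathAlgebra K) :=
  Function.Surjective.module K
    ({ toFun := mk G K, map_zero' := rfl, map_add' := fun _ _ => rfl } :
      G.FreeAlg K →+ G.LeavittPathAlgebra K)
    mk_surjective mk_smul

instance : IsScalarTower K (G.LeavittPathAlgebra K) (G.LeavittPathAlgebra K) where
  smul_assoc k x y := by
    obtain ⟨a, rfl⟩ := mk_surjective x
    obtain ⟨b, rfl⟩ := mk_surjective y
    simp only [smul_eq_mul, ← mk_smul, ← mk_mul, smul_mul_assoc]

instance : SMulCommClass K (G.LeavittPathAlgebra K) (G.LeavittPathAlgebra K) where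
  smul_comm k x y := by
    obtain ⟨a, rfl⟩ := mk_surjective x
    obtain ⟨b, rfl⟩ := mk_surjective y
    simp only [smul_eq_mul, ← mk_smul, ← mk_mul, mul_smul_comm]

variable (K) in
/-- The element `p_A`. -/
noncomputable def p (A : G.GenVertex) : G.LeavittPathAlgebra K := mk G K (G.gen K (.p A))

variable (G K) in
/-- The element `s_e`. -/
noncomputable def s (e : E) : G.LeavittPathAlgebra K := mk G K (G.gen K (.s e))

variable (G K) in
/-- The element `s_e^*`. -/
noncomputable def sStar (e : E) : G.LeavittPathAlgebra K := mk G K (G.gen K (.sStar e))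

variable (G K) in
/-- The element `s_α = s_{e_1} ⋯ s_{e_n}` for a nonempty sequence `α = e_1 ⋯ e_n` of edges.
(The value `0` at the empty sequence is a placeholder.) -/
noncomputable def sPath : List E → G.LeavittPathAlgebra K
  | [] => 0
  | [e] => s G K e
  | e :: f :: l => s G K e * sPath (f :: l)

/-- Powers with positive exponent (the algebra need not have a unit). -/
noncomputable def posPow (x : G.LeavittPathAlgebra K) (n : ℕ+) : G.LeavittPathAlgebra K :=
  PNat.recOn n x fun _ y => y * x

end LeavittPathAlgebra

/-- The range `r(e_1 ⋯ e_n) = r(e_n)` of a nonempty sequence of edges. -/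
def pathRange (G : Ultragraph V E) (c : List E) : Set V :=
  {x | ∃ e ∈ c.getLast?, x ∈ G.range e}

/-- The sequence of edges `c = e_1 ⋯ e_n` is a cycle based at `v`: `n ≥ 1`, consecutive edges
are composable, `v = s(e_1) ∈ r(e_n)`, and the sources of the edges are pairwise distinct. -/
structure IsCycleAt (G : Ultragraph V E) (c : List E) (v : V) : Prop where
  isPath : c.IsChain fun e f => G.source f ∈ G.range e
  source_eq : c.head?.map G.source = some v
  mem_range : v ∈ G.pathRange c
  nodup : (c.map G.source).Nodup

open LeavittPathAlgebra in
/-- The elements `(p_A + ∑ᵢ kᵢ s_c^{rᵢ}) (p_A - ∑_{e ∈ S} s_e s_e^*)`, where `S` is a finite set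
of edges with common source `v ∈ A`, the `rᵢ` are positive integers, and, whenever some `kᵢ` is
nonzero, `c` is a cycle based at `v`, it is the only one, and `A ⊆ r(c)`. -/
def IsStandardGenerator (G : Ultragraph V E) (K : Type w) [Field K]
    (x : G.LeavittPathAlgebra K) : Prop :=
  ∃ (A : G.GenVertex) (v : V) (S : Finset E) (m : ℕ) (k : Fin m → K) (r : Fin m → ℕ+)
    (c : List E),
    v ∈ A.1 ∧ (∀ e ∈ S, G.source e = v) ∧
    ((∃ i, k i ≠ 0) → G.IsCycleAt c v ∧ (∀ d, G.IsCycleAt d v → d = c) ∧ A.1 ⊆ G.pathRange c) ∧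
    x = (p K A + ∑ i, k i • posPow (sPath G K c) (r i)) *
      (p K A - ∑ e ∈ S, s G K e * sStar G K e)

end Ultragraph

/-! Let `J` be an ideal that contains every standard element of `I`; the claim is that `I ⊆ J`. Put
q_S = 1 - ∑_{e ∈ S} s_e s_e^*. This needs a unit, so the argument runs in a unital ring, and
`unitizationIdeal` carries ideals into the unitization.

Every element is a combination of monomials s_α p_A s_β^*. The ghost parts s_β^* are removed by
writing x = x q_T + ∑_{e ∈ T} (x s_e) s_e^*, where T contains the first edges of the β that occur:
then x q_T = y q_T with y free of ghosts, and each x s_e has shorter ghosts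
(`mem_of_mem_monomialSpan`).

For y free of ghosts, cutting with small p_B gives y p_B = k p_B + u with u a combination of
nonempty paths. Terms such as u are handled by u = ∑ s_e (s_e^* u), which shortens paths. If k ≠ 0,
what remains is p_B alone or p_w plus closed paths at one vertex w (`pathSpan_mul_defect_mem`).

The core is `corner_mem`, about z = (p_w + y) q_S with y a combination of closed paths at w. Closed
paths factor uniquely into first returns. If every first return begins with an edge of S, then q_S z
= p_w q_S, a standard element, and z is a left multiple of it. If there is just one first return c,
it is the only cycle at w and z itself is standard. If there are two, c ≠ d, then γ = c^{n+1} d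
satisfies p_w s_γ^* z s_γ p_w = p_w, so p_w ∈ I. -/

/-! ### Combinatorics of closed paths and first returns. -/

namespace Ultragraph

variable {V E : Type*} {G : Ultragraph V E} {w : V}

/-- A closed path based at `w`: a cycle whose sources may repeat. -/
structure IsClosedPathAt (G : Ultragraph V E) (c : List E) (w : V) : Prop where
  isPath : c.IsChain fun e f => G.source f ∈ G.range e
  source_eq : c.head?.map G.source = some w
  mem_range : w ∈ G.pathRange c

/-- The list is empty or its first edge has source `w`. -/
def StartsAt (G : Ultragraph V E) (w : V) (x : List E) : Prop := ∀ e ∈ x.head?, G.source e = w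

/-- A closed path based at `w` that does not visit `w` in between. -/
structure IsFirstReturnAt (G : Ultragraph V E) (c : List E) (w : V) : Prop
    extends G.IsClosedPathAt c w where
  source_ne : ∀ e ∈ c.tail, G.source e ≠ w

theorem pathRange_append {l m : List E} (hm : m ≠ []) :
    G.pathRange (l ++ m) = G.pathRange m := by
  simp [pathRange, List.getLast?_append_of_ne_nil _ hm]

theorem IsClosedPathAt.ne_nil {c : List E} (h : G.IsClosedPathAt c w) : c ≠ [] := by
  rintro rfl
  simpa using h.source_eq

theorem IsClosedPathAt.startsAt {c : List E} (h : G.IsClosedPathAt c w) : G.StartsAt w c := by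
  intro e he
  have := h.source_eq
  rw [Option.mem_def.1 he] at this
  simpa using this

theorem IsClosedPathAt.exists_cons {c : List E} (h : G.IsClosedPathAt c w) :
    ∃ e l, c = e :: l ∧ G.source e = w := by
  obtain _ | ⟨e, l⟩ := c
  · exact absurd rfl h.ne_nil
  · exact ⟨e, l, rfl, h.startsAt e rfl⟩

theorem IsClosedPathAt.startsAt_append {c : List E} (h : G.IsClosedPathAt c w) (x : List E) :
    G.StartsAt w (c ++ x) := by
  obtain ⟨e, l, rfl, he⟩ := h.exists_cons
  rintro f ⟨⟩
  exact he

theorem IsClosedPathAt.append {c d : List E} (hc : G.IsClosedPathAt c w)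
    (hd : G.IsClosedPathAt d w) : G.IsClosedPathAt (c ++ d) w where
  isPath := by
    refine List.isChain_append.2 ⟨hc.isPath, hd.isPath, fun x hx y hy => ?_⟩
    rw [hd.startsAt y hy]
    obtain ⟨e, he, hw⟩ := hc.mem_range
    rw [Option.mem_def] at he hx
    rw [he] at hx
    cases hx
    exact hw
  source_eq := by
    obtain ⟨e, l, rfl, h⟩ := hc.exists_cons
    simp [h]
  mem_range := by
    rw [pathRange_append hd.ne_nil]
    exact hd.mem_range

/-- Cut just before the second edge with source `w`, if there is one. Iterating this factors a
closed path into first returns. -/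
theorem IsClosedPathAt.exists_firstReturn {c : List E} (h : G.IsClosedPathAt c w) :
    ∃ b x, c = b ++ x ∧ G.IsFirstReturnAt b w ∧ (x = [] ∨ G.IsClosedPathAt x w) := by
  classical
  obtain ⟨e, l, rfl, he⟩ := h.exists_cons
  set P : E → Bool := fun f => decide (G.source f ≠ w) with hP
  have hl : e :: l = (e :: l.takeWhile P) ++ l.dropWhile P := by
    simp [List.takeWhile_append_dropWhile]
  have hne : ∀ f ∈ l.takeWhile P, G.source f ≠ w := fun f hf => by
    simpa [hP] using List.mem_takeWhile_imp hf
  refine ⟨e :: l.takeWhile P, l.dropWhile P, hl, ?_, ?_⟩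
  · have hch := h.isPath
    rw [hl] at hch
    refine ⟨⟨(List.isChain_append.1 hch).1, by simp [he], ?_⟩, hne⟩
    cases hx : l.dropWhile P with
    | nil =>
      have := h.mem_range
      rw [hl, hx, List.append_nil] at this
      exact this
    | cons f x =>
      have hf : G.source f = w := by
        have := List.head?_dropWhile_not P l
        rw [hx] at this
        simpa [hP] using this
      have hlast := (List.isChain_append.1 hch).2.2
      rw [hx] at hlast
      refine ⟨_, List.getLast?_eq_getLast_of_ne_nil (by simp), ?_⟩
      rw [← hf]
      exact hlast _ (List.getLast?_eq_getLast_of_ne_nil (by simp)) f rfl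
  · cases hx : l.dropWhile P with
    | nil => exact Or.inl rfl
    | cons f x =>
      have hf : G.source f = w := by
        have := List.head?_dropWhile_not P l
        rw [hx] at this
        simpa [hP] using this
      rw [hx] at hl
      right
      have hch := h.isPath
      have hr := h.mem_range
      rw [hl] at hch hr
      rw [pathRange_append (by simp)] at hr
      exact ⟨(List.isChain_append.1 hch).2.1, by simp [hf], hr⟩

/-- The place where the first return ends can be read off the whole list: it is the first later edge
with source `w`, or the end. Hence the factorization into first returns is unique. -/
theorem IsFirstReturnAt.append_inj {b b' x x' : List E} (hb : G.IsFirstReturnAt b w)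
    (hb' : G.IsFirstReturnAt b' w) (hx : G.StartsAt w x) (hx' : G.StartsAt w x')
    (h : b ++ x = b' ++ x') : b = b' ∧ x = x' := by
  classical
  set P : E → Bool := fun f => decide (G.source f ≠ w) with hP
  have key : ∀ {l y : List E}, (∀ f ∈ l, G.source f ≠ w) → G.StartsAt w y →
      (l ++ y).takeWhile P = l := by
    intro l y hl hy
    rw [List.takeWhile_append_of_pos (by simpa [hP] using hl)]
    cases y with
    | nil => simp
    | cons f y =>
      have : G.source f = w := hy f rfl
      simp [hP, this]
  obtain ⟨e, l, rfl, he⟩ := hb.exists_cons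
  obtain ⟨e', l', rfl, he'⟩ := hb'.exists_cons
  simp only [List.cons_append, List.cons.injEq] at h
  obtain ⟨rfl, h⟩ := h
  have hl : l = l' := by
    exact (key hb.source_ne hx).symm.trans ((congrArg _ h).trans (key hb'.source_ne hx'))
  subst hl
  exact ⟨rfl, List.append_cancel_left h⟩

/-- The `n`-fold concatenation of a list with itself. -/
def listPow (c : List E) (n : ℕ) : List E := (List.replicate n c).flatten

theorem listPow_zero (c : List E) : listPow c 0 = [] := rfl

theorem listPow_succ (c : List E) (n : ℕ) : listPow c (n + 1) = c ++ listPow c n := by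
  simp [listPow, List.replicate_succ]

theorem listPow_add (c : List E) (m n : ℕ) : listPow c (m + n) = listPow c m ++ listPow c n := by
  rw [listPow, ← List.replicate_append_replicate, List.flatten_append]; rfl

theorem IsClosedPathAt.listPow_append {c d : List E} (hc : G.IsClosedPathAt c w)
    (hd : G.IsClosedPathAt d w) (n : ℕ) : G.IsClosedPathAt (listPow c n ++ d) w := by
  induction n with
  | zero => exact hd
  | succ n ih =>
    rw [listPow_succ, List.append_assoc]
    exact hc.append ih

theorem eq_listPow_of_firstReturn_unique {c : List E}
    (hc : ∀ b, G.IsFirstReturnAt b w → b = c) (n : ℕ) :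
    ∀ α : List E, α.length ≤ n → G.IsClosedPathAt α w → ∃ r, α = listPow c (r + 1) := by
  induction n with
  | zero =>
    intro α hα h
    exact absurd (List.length_eq_zero_iff.1 (Nat.le_zero.1 hα)) h.ne_nil
  | succ n ih =>
    intro α hα h
    obtain ⟨b, x, rfl, hb, hx⟩ := h.exists_firstReturn
    obtain rfl := hc b hb
    rcases hx with rfl | hx
    · exact ⟨0, by simp [listPow]⟩
    · have hpos := List.length_pos_iff.2 hb.ne_nil
      rw [List.length_append] at hα
      obtain ⟨r, hr⟩ := ih x (by omega) hx
      exact ⟨r + 1, by rw [listPow_succ, ← hr]⟩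

/-- If `c ≠ d` are first returns, then a nonempty closed path `α` followed by `c ^ N d` never
continues `c ^ N d` at `w`, once `N` is large. -/
theorem append_listPow_ne {c d : List E} (hc : G.IsFirstReturnAt c w)
    (hd : G.IsFirstReturnAt d w) (hcd : c ≠ d) {N : ℕ} {α x : List E}
    (hα : G.IsClosedPathAt α w) (hN : α.length ≤ N) (hx : G.StartsAt w x) :
    α ++ (listPow c N ++ d) ≠ listPow c N ++ d ++ x := by
  have hcd' : ∀ k, G.StartsAt w (listPow c k ++ d) := fun k =>
    (hc.toIsClosedPathAt.listPow_append hd.toIsClosedPathAt k).startsAt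
  -- The contradiction always comes from here: once `α` is used up and the common powers of `c` are
  -- cancelled, the leading first returns are `c` and `d`.
  have base : ∀ k, listPow c (k + 1) ++ d ≠ d ++ x := by
    intro k h
    rw [listPow_succ, List.append_assoc] at h
    exact hcd (hc.append_inj hd (hcd' k) hx h).1
  have hstep : ∀ m (α : List E), G.IsClosedPathAt α w →
      α ++ (listPow c N ++ d) = listPow c (m + 1) ++ (d ++ x) →
      ∃ β : List E, β.length < α.length ∧ (β = [] ∨ G.IsClosedPathAt β w) ∧
        β ++ (listPow c N ++ d) = listPow c m ++ (d ++ x) := by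
    intro m α hα h
    obtain ⟨b, β, rfl, hb, hβ⟩ := hα.exists_firstReturn
    rw [listPow_succ, List.append_assoc, List.append_assoc] at h
    have hs : G.StartsAt w (β ++ (listPow c N ++ d)) := by
      rcases hβ with rfl | hβ
      · exact hcd' N
      · exact (hβ.append (hc.toIsClosedPathAt.listPow_append hd.toIsClosedPathAt N)).startsAt
    have hs' : G.StartsAt w (listPow c m ++ (d ++ x)) := by
      rw [← List.append_assoc]
      exact (hc.toIsClosedPathAt.listPow_append hd.toIsClosedPathAt m).startsAt_append x
    have hpos := List.length_pos_iff.2 hb.ne_nil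
    exact ⟨β, by rw [List.length_append]; omega, hβ, (hb.append_inj hc hs hs' h).2⟩
  -- Each step strips one first return from `α` and one `c` from the right side. The strict bound `m
  -- < N` leaves at least one `c` on the left after cancellation, as `base` requires; it holds
  -- because the nonempty `α` is stripped once before `key` is applied.
  have key : ∀ m, ∀ α : List E, m < N → α.length ≤ m → (α = [] ∨ G.IsClosedPathAt α w) →
      α ++ (listPow c N ++ d) ≠ listPow c m ++ (d ++ x) := by
    intro m
    induction m with
    | zero =>
      intro α hm hl _ h
      obtain rfl := List.length_eq_zero_iff.1 (Nat.le_zero.1 hl)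
      obtain ⟨k, rfl⟩ := Nat.exists_eq_add_of_lt hm
      exact base (0 + k) h
    | succ m ih =>
      rintro α hm hl (rfl | hα) h
      · obtain ⟨k, rfl⟩ := Nat.exists_eq_add_of_lt hm
        rw [Nat.add_assoc (m + 1), listPow_add, List.nil_append, List.append_assoc] at h
        exact base k (List.append_cancel_left h)
      · obtain ⟨β, hlt, hβ, h⟩ := hstep m α hα h
        exact ih β (by omega) (by omega) hβ h
  intro h
  have hpos := List.length_pos_iff.2 hα.ne_nil
  obtain ⟨M, rfl⟩ : ∃ M, N = M + 1 := ⟨N - 1, by omega⟩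
  rw [List.append_assoc] at h
  obtain ⟨β, hlt, hβ, h⟩ := hstep M α hα (by simpa using h)
  exact key M β (by omega) (by omega) hβ h

theorem IsCycleAt.isClosedPathAt {c : List E} (h : G.IsCycleAt c w) : G.IsClosedPathAt c w :=
  ⟨h.isPath, h.source_eq, h.mem_range⟩

/-- If there is only one first return, then it is a cycle, and it is the only cycle. -/
theorem IsFirstReturnAt.isCycleAt_of_unique {c : List E} (h : G.IsFirstReturnAt c w)
    (hc : ∀ b, G.IsFirstReturnAt b w → b = c) : G.IsCycleAt c w where
  isPath := h.isPath
  source_eq := h.source_eq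
  mem_range := h.mem_range
  nodup := by
    -- All closed paths are powers of `c`, so none is shorter. A repeated source would allow the
    -- segment between its two occurrences to be cut out.
    have hmin : ∀ d, G.IsClosedPathAt d w → c.length ≤ d.length := by
      intro d hd
      obtain ⟨r, rfl⟩ := eq_listPow_of_firstReturn_unique hc _ d le_rfl hd
      rw [listPow_succ, List.length_append]
      omega
    by_contra hdup
    rw [List.Nodup, List.pairwise_map, List.pairwise_iff_forall_sublist] at hdup
    push Not at hdup
    obtain ⟨e, f, hef, hs⟩ := hdup
    obtain ⟨l₁, m, rfl, he, hf⟩ : ∃ l₁ m, c = l₁ ++ m ∧ e ∈ l₁ ∧ f ∈ m := by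
      obtain ⟨l₁, m, rfl, he, hf⟩ := List.cons_sublist_iff.1 hef
      exact ⟨l₁, m, rfl, he, List.singleton_sublist.1 hf⟩
    obtain ⟨a, a', rfl⟩ := List.append_of_mem he
    obtain ⟨b, b', rfl⟩ := List.append_of_mem hf
    refine absurd (hmin (a ++ f :: b') ⟨?_, ?_, ?_⟩) ?_
    · have h1 := h.isPath
      have h2 : (f :: b').IsChain fun e f => G.source f ∈ G.range e := by
        rw [← List.append_assoc] at h1
        exact (List.isChain_append.1 h1).2.1
      rw [List.append_assoc] at h1
      have h3 := List.isChain_append.1 h1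
      refine List.isChain_append.2 ⟨h3.1, h2, fun x hx y hy => ?_⟩
      obtain rfl : f = y := by simpa using hy
      rw [← hs]
      exact h3.2.2 x hx e rfl
    · have := h.source_eq
      cases a with
      | nil => simpa [hs] using this
      | cons => simpa using this
    · have := h.mem_range
      rw [← List.append_assoc, pathRange_append (by simp)] at this
      rw [pathRange_append (by simp)]
      exact this
    · simp only [List.length_append, List.length_cons]
      omega

theorem IsCycleAt.isFirstReturnAt {c : List E} (h : G.IsCycleAt c w) : G.IsFirstReturnAt c w where
  toIsClosedPathAt := h.isClosedPathAt
  source_ne := by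
    obtain ⟨e, l, rfl, he⟩ := h.isClosedPathAt.exists_cons
    intro f hf hw
    have := h.nodup
    rw [List.map_cons, List.nodup_cons] at this
    exact this.1 (List.mem_map.2 ⟨f, hf, hw.trans he.symm⟩)

end Ultragraph

/-! ### Computation rules for Leavitt families in a unital ring. -/

namespace Ultragraph

/-- Elements of a unital ring that satisfy the relations of a Leavitt path algebra other than the
one at regular vertices. The values `p A` matter only for generalized vertices `A`. -/
structure LeavittFamily {V E : Type*} (G : Ultragraph V E) (R : Type*) [Ring R] where
  p : Set V → R
  s : E → R
  t : E → R
  p_empty : p ∅ = 0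
  p_mul_p {A B : Set V} : G.IsGenVertex A → G.IsGenVertex B → p A * p B = p (A ∩ B)
  p_union {A B : Set V} : G.IsGenVertex A → G.IsGenVertex B →
    p (A ∪ B) = p A + p B - p (A ∩ B)
  source_s (e : E) : p {G.source e} * s e = s e
  s_range (e : E) : s e * p (G.range e) = s e
  range_t (e : E) : p (G.range e) * t e = t e
  t_source (e : E) : t e * p {G.source e} = t e
  t_mul_s_self (e : E) : t e * s e = p (G.range e)
  t_mul_s_ne {e f : E} : e ≠ f → t e * s f = 0

namespace LeavittFamily

variable {V E R : Type*} {G : Ultragraph V E} [Ring R] (F : G.LeavittFamily R) {w : V}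
  {A B U : Set V}

/-- The product `s_{e_1} ⋯ s_{e_n}`. -/
def sProd (α : List E) : R := (α.map F.s).prod

/-- The product `s_{e_n}^* ⋯ s_{e_1}^*`. -/
def tProd (β : List E) : R := (β.reverse.map F.t).prod

/-- The element `1 - ∑_{e ∈ S} s_e s_e^*`. -/
def defect (S : Finset E) : R := 1 - ∑ e ∈ S, F.s e * F.t e

@[simp] theorem sProd_nil : F.sProd [] = 1 := rfl

@[simp] theorem sProd_cons (e : E) (α : List E) : F.sProd (e :: α) = F.s e * F.sProd α := by
  simp [sProd]

theorem sProd_append (α β : List E) : F.sProd (α ++ β) = F.sProd α * F.sProd β := by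
  simp [sProd]

theorem sProd_listPow (c : List E) (n : ℕ) : F.sProd (listPow c n) = F.sProd c ^ n := by
  induction n with
  | zero => simp [listPow_zero]
  | succ n ih => rw [listPow_succ, sProd_append, ih, pow_succ']

@[simp] theorem tProd_nil : F.tProd [] = 1 := rfl

@[simp] theorem tProd_cons (e : E) (α : List E) : F.tProd (e :: α) = F.tProd α * F.t e := by
  simp [tProd]

theorem tProd_append (α β : List E) : F.tProd (α ++ β) = F.tProd β * F.tProd α := by
  simp [tProd]

theorem p_mul_self (hA : G.IsGenVertex A) : F.p A * F.p A = F.p A := by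
  rw [F.p_mul_p hA hA, Set.inter_self]

theorem p_mul_s_of_mem (hA : G.IsGenVertex A) {e : E} (h : G.source e ∈ A) :
    F.p A * F.s e = F.s e := by
  rw [← F.source_s, ← mul_assoc, F.p_mul_p hA (.singleton _),
    Set.inter_eq_right.2 (Set.singleton_subset_iff.2 h)]

theorem p_mul_s_of_notMem (hA : G.IsGenVertex A) {e : E} (h : G.source e ∉ A) :
    F.p A * F.s e = 0 := by
  rw [← F.source_s, ← mul_assoc, F.p_mul_p hA (.singleton _),
    Set.inter_singleton_eq_empty.2 h, F.p_empty, zero_mul]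

theorem t_mul_p_of_mem (hA : G.IsGenVertex A) {e : E} (h : G.source e ∈ A) :
    F.t e * F.p A = F.t e := by
  rw [← F.t_source, mul_assoc, F.p_mul_p (.singleton _) hA,
    Set.inter_eq_left.2 (Set.singleton_subset_iff.2 h)]

theorem t_mul_p_of_notMem (hA : G.IsGenVertex A) {e : E} (h : G.source e ∉ A) :
    F.t e * F.p A = 0 := by
  rw [← F.t_source, mul_assoc, F.p_mul_p (.singleton _) hA,
    Set.singleton_inter_eq_empty.2 h, F.p_empty, mul_zero]

theorem p_split (hA : G.IsGenVertex A) (hU : G.IsGenVertex U) :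
    F.p U = F.p (U ∩ A) + F.p (U \ A) := by
  have h := F.p_union (hU.inter hA) (hU.sdiff hA)
  have he : U ∩ A ∩ (U \ A) = ∅ := by ext; simp; tauto
  rwa [Set.inter_union_sdiff, he, F.p_empty, sub_zero] at h

/-- Each s_e s_e^* lies under the projection of the single vertex s(e), so p_A fixes or kills it
from both sides alike. -/
theorem p_commute_defect (hA : G.IsGenVertex A) (S : Finset E) :
    F.p A * F.defect S = F.defect S * F.p A := by
  rw [defect, mul_sub, sub_mul, mul_one, one_mul, Finset.mul_sum, Finset.sum_mul]
  congr 1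
  refine Finset.sum_congr rfl fun e _ => ?_
  by_cases h : G.source e ∈ A
  · rw [← mul_assoc, F.p_mul_s_of_mem hA h, mul_assoc, F.t_mul_p_of_mem hA h]
  · rw [← mul_assoc, F.p_mul_s_of_notMem hA h, mul_assoc, F.t_mul_p_of_notMem hA h, zero_mul,
      mul_zero]

theorem p_mul_defect_of_disjoint (hA : G.IsGenVertex A) {S : Finset E}
    (h : ∀ e ∈ S, G.source e ∉ A) : F.p A * F.defect S = F.p A := by
  rw [defect, mul_sub, mul_one, Finset.mul_sum, Finset.sum_eq_zero, sub_zero]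
  intro e he
  rw [← mul_assoc, F.p_mul_s_of_notMem hA (h e he), zero_mul]

theorem t_mul_s [DecidableEq E] (e f : E) :
    F.t e * F.s f = if e = f then F.p (G.range e) else 0 := by
  split_ifs with h
  · rw [h, F.t_mul_s_self]
  · exact F.t_mul_s_ne h

theorem defect_mul_s_of_mem {S : Finset E} {e : E} (he : e ∈ S) : F.defect S * F.s e = 0 := by
  classical
  rw [defect, sub_mul, one_mul, Finset.sum_mul]
  simp [mul_assoc, F.t_mul_s, he, F.s_range]

theorem defect_mul_s_of_notMem {S : Finset E} {e : E} (he : e ∉ S) :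
    F.defect S * F.s e = F.s e := by
  classical
  rw [defect, sub_mul, one_mul, Finset.sum_mul]
  simp [mul_assoc, F.t_mul_s, he]

theorem t_mul_defect_of_mem {S : Finset E} {e : E} (he : e ∈ S) : F.t e * F.defect S = 0 := by
  classical
  rw [defect, mul_sub, mul_one, Finset.mul_sum]
  simp [← mul_assoc, F.t_mul_s, he, F.range_t]

theorem defect_mul_self (S : Finset E) : F.defect S * F.defect S = F.defect S := by
  nth_rw 1 [defect]
  rw [sub_mul, one_mul, Finset.sum_mul, Finset.sum_eq_zero, sub_zero]
  intro e he
  rw [mul_assoc, F.t_mul_defect_of_mem he, mul_zero]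

theorem p_mul_sProd_of_startsAt {α : List E} (hα : α ≠ []) (h : G.StartsAt w α) :
    F.p {w} * F.sProd α = F.sProd α := by
  obtain _ | ⟨e, l⟩ := α
  · exact absurd rfl hα
  · rw [sProd_cons, ← mul_assoc, F.p_mul_s_of_mem (.singleton w) (h e rfl)]

theorem p_mul_sProd_of_not_startsAt {α : List E} (h : ¬ G.StartsAt w α) :
    F.p {w} * F.sProd α = 0 := by
  obtain _ | ⟨e, l⟩ := α
  · exact absurd (fun e he => by cases he) h
  · rw [sProd_cons, ← mul_assoc, F.p_mul_s_of_notMem (.singleton w), zero_mul]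
    intro h'
    exact h fun f hf => by cases hf; exact h'

theorem sProd_mul_p_of_notMem {α : List E} (hα : α ≠ []) (h : w ∉ G.pathRange α) :
    F.sProd α * F.p {w} = 0 := by
  obtain rfl | ⟨l, e, rfl⟩ := List.eq_nil_or_concat' α
  · exact absurd rfl hα
  · have he : w ∉ G.range e := by simpa [pathRange] using h
    rw [sProd_append, mul_assoc]
    have : F.s e * F.p {w} = 0 := by
      rw [← F.s_range, mul_assoc, F.p_mul_p (.range e) (.singleton w),
        Set.inter_singleton_eq_empty.2 he, F.p_empty, mul_zero]
    simp [this]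

theorem s_mul_s_of_notMem {e f : E} (h : G.source f ∉ G.range e) : F.s e * F.s f = 0 := by
  rw [← F.s_range, mul_assoc, F.p_mul_s_of_notMem (.range e) h, mul_zero]

theorem sProd_of_not_isChain {α : List E}
    (h : ¬ α.IsChain fun e f => G.source f ∈ G.range e) : F.sProd α = 0 := by
  induction α with
  | nil => exact absurd List.IsChain.nil h
  | cons e α ih =>
    cases α with
    | nil => exact absurd (List.IsChain.singleton e) h
    | cons f α =>
      by_cases hf : G.source f ∈ G.range e
      · rw [sProd_cons, ih fun h' => h (List.isChain_cons_cons.2 ⟨hf, h'⟩), mul_zero]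
      · rw [sProd_cons, sProd_cons, ← mul_assoc, F.s_mul_s_of_notMem hf, zero_mul]

theorem corner_sProd_of_not_closed {α : List E} (hα : α ≠ []) (h : ¬ G.IsClosedPathAt α w) :
    F.p {w} * F.sProd α * F.p {w} = 0 := by
  by_cases h1 : G.StartsAt w α
  · by_cases h2 : w ∈ G.pathRange α
    · rw [F.sProd_of_not_isChain fun h3 => h ⟨h3, ?_, h2⟩, mul_zero, zero_mul]
      obtain _ | ⟨e, l⟩ := α
      · exact absurd rfl hα
      · simp [h1 e rfl]
    · rw [mul_assoc, F.sProd_mul_p_of_notMem hα h2, mul_zero]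
  · rw [F.p_mul_sProd_of_not_startsAt h1, zero_mul]

theorem tProd_mul_sProd_self {α : List E} (hα : G.IsClosedPathAt α w) :
    F.p {w} * (F.tProd α * F.sProd α) * F.p {w} = F.p {w} := by
  have key : ∀ α : List E, α ≠ [] → (α.IsChain fun e f => G.source f ∈ G.range e) →
      ∃ e ∈ α.getLast?, F.tProd α * F.sProd α = F.p (G.range e) := by
    intro α
    induction α with
    | nil => exact fun h => absurd rfl h
    | cons e α ih =>
      intro _ hch
      cases α with
      | nil => exact ⟨e, rfl, by simp [F.t_mul_s_self]⟩
      | cons f α =>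
        obtain ⟨hf, hch⟩ := List.isChain_cons_cons.1 hch
        obtain ⟨g, hg, h⟩ := ih (by simp) hch
        refine ⟨g, by simpa using hg, ?_⟩
        rw [← h, tProd_cons, sProd_cons, mul_assoc, ← mul_assoc (F.t e), F.t_mul_s_self,
          sProd_cons, ← mul_assoc (F.p _), F.p_mul_s_of_mem (.range e) hf]
  obtain ⟨e, he, h⟩ := key α hα.ne_nil hα.isPath
  obtain ⟨e', he', hw⟩ := hα.mem_range
  obtain rfl : e = e' := by
    rw [Option.mem_def] at he he'
    exact Option.some.inj (he.symm.trans he')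
  rw [h, F.p_mul_p (.singleton w) (.range e), F.p_mul_p ((IsGenVertex.singleton w).inter (.range e))
    (.singleton w)]
  congr 1
  ext x
  simp only [Set.mem_inter_iff, Set.mem_singleton_iff]
  constructor
  · exact fun h => h.2
  · rintro rfl
    exact ⟨⟨rfl, hw⟩, rfl⟩

/-- Either the paths differ at some edge within `γ`, where s_e^* s_f = 0, or `δ` continues `γ` at a
vertex other than `w` and p_w kills the continuation. The length bound excludes a proper prefix `δ`
of `γ`, for which a ghost path would survive. -/
theorem tProd_mul_sProd_eq_zero {γ : List E} (hγ : γ ≠ []) : ∀ {δ : List E},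
    γ.length ≤ δ.length → (∀ x, G.StartsAt w x → δ ≠ γ ++ x) →
    F.p {w} * (F.tProd γ * F.sProd δ) = 0 := by
  induction γ with
  | nil => exact absurd rfl hγ
  | cons e γ ih =>
    intro δ hl h
    obtain _ | ⟨f, δ⟩ := δ
    · simp at hl
    rw [tProd_cons, sProd_cons, mul_assoc, ← mul_assoc (F.t e)]
    by_cases hef : e = f
    · subst hef
      rw [F.t_mul_s_self]
      cases γ with
      | nil =>
        have : ¬ G.StartsAt w δ := fun hs => h δ hs rfl
        obtain _ | ⟨g, δ⟩ := δ
        · exact absurd (fun e he => by cases he) this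
        have hg : G.source g ∉ ({w} ∩ G.range e : Set V) := fun hg =>
          this fun f hf => by cases hf; exact hg.1
        rw [tProd_nil, one_mul, ← mul_assoc, F.p_mul_p (.singleton w) (.range e), sProd_cons,
          ← mul_assoc, F.p_mul_s_of_notMem ((IsGenVertex.singleton w).inter (.range e)) hg,
          zero_mul]
      | cons g γ =>
        obtain _ | ⟨g', δ⟩ := δ
        · simp at hl
        rw [sProd_cons, ← mul_assoc (F.p (G.range e))]
        by_cases hg : G.source g' ∈ G.range e
        · rw [F.p_mul_s_of_mem (.range e) hg, ← sProd_cons]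
          exact ih (by simp) (by simpa using hl) fun x hx hx' => h x hx (by simp [hx'])
        · rw [F.p_mul_s_of_notMem (.range e) hg, zero_mul, mul_zero, mul_zero]
    · rw [F.t_mul_s_ne hef, zero_mul, mul_zero, mul_zero]

end LeavittFamily
end Ultragraph

/-! ### Standard elements and the corner at a vertex. -/

namespace Ultragraph
namespace LeavittFamily

variable {V E R : Type*} {G : Ultragraph V E} [Ring R] (F : G.LeavittFamily R) {w : V}
  {A B U : Set V}

theorem p_singleton_mul_defect (w : V) [DecidablePred fun e => G.source e = w] (S : Finset E) :
    F.p {w} * F.defect S = F.p {w} - ∑ e ∈ S with G.source e = w, F.s e * F.t e := by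
  rw [defect, mul_sub, mul_one, Finset.mul_sum, Finset.sum_filter]
  congr 1
  refine Finset.sum_congr rfl fun e _ => ?_
  split_ifs with h
  · rw [← mul_assoc, F.p_mul_s_of_mem (.singleton w) h]
  · rw [← mul_assoc, F.p_mul_s_of_notMem (.singleton w) h, zero_mul]

variable (K : Type*) [Field K] [Algebra K R]

/-- The elements `(p_A + ∑ᵢ kᵢ s_c^{rᵢ}) (p_A - ∑_{e ∈ S} s_e s_e^*)` as in
`Ultragraph.IsStandardGenerator`. -/
def IsStandard (x : R) : Prop :=
  ∃ (A : Set V) (v : V) (S : Finset E) (m : ℕ) (k : Fin m → K) (r : Fin m → ℕ+) (c : List E),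
    G.IsGenVertex A ∧ v ∈ A ∧ (∀ e ∈ S, G.source e = v) ∧
    ((∃ i, k i ≠ 0) → G.IsCycleAt c v ∧ (∀ d, G.IsCycleAt d v → d = c) ∧ A ⊆ G.pathRange c) ∧
    x = (F.p A + ∑ i, k i • F.sProd c ^ (r i : ℕ)) * (F.p A - ∑ e ∈ S, F.s e * F.t e)

variable {F K}

theorem isStandard_p (hA : G.IsGenVertex A) (h : A.Nonempty) : F.IsStandard K (F.p A) := by
  obtain ⟨v, hv⟩ := h
  refine ⟨A, v, ∅, 0, Fin.elim0, Fin.elim0, [], hA, hv, by simp, fun ⟨i, _⟩ => i.elim0, ?_⟩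
  simp [F.p_mul_self hA]

theorem isStandard_p_mul_defect (w : V) (S : Finset E) :
    F.IsStandard K (F.p {w} * F.defect S) := by
  classical
  refine ⟨{w}, w, S.filter fun e => G.source e = w, 0, Fin.elim0, Fin.elim0, [], .singleton w,
    rfl, by simp, fun ⟨i, _⟩ => i.elim0, ?_⟩
  rw [← p_singleton_mul_defect, Finset.sum_of_isEmpty, add_zero, ← mul_assoc,
    F.p_mul_self (.singleton w)]

/-- The factor p_w at the right end of `y` can be moved onto the defect, where it discards the edges
of `S` not starting at `w`. -/
theorem isStandard_of_unique_cycle {c : List E} (hc : G.IsCycleAt c w)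
    (hu : ∀ d, G.IsCycleAt d w → d = c) (S : Finset E) {y : R}
    (hy : y ∈ Submodule.span K {x | ∃ r : ℕ, x = F.sProd (listPow c (r + 1)) * F.p {w}}) :
    F.IsStandard K ((F.p {w} + y) * F.defect S) := by
  classical
  obtain ⟨m, k, g, rfl⟩ := Submodule.mem_span_set'.1 hy
  choose r hr using fun i => (g i).2
  refine ⟨{w}, w, S.filter fun e => G.source e = w, m, k, fun i => (r i).succPNat, c,
    .singleton w, rfl, by simp, fun _ => ⟨hc, hu, ?_⟩, ?_⟩
  · exact Set.singleton_subset_iff.2 hc.mem_range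
  · rw [← p_singleton_mul_defect, ← mul_assoc, add_mul _ _ (F.p {w}), F.p_mul_self (.singleton w),
      Finset.sum_mul]
    simp only [hr, sProd_listPow, Nat.succPNat_coe, Nat.succ_eq_add_one, smul_mul_assoc]

variable {I J : TwoSidedIdeal R}

theorem smul_mem_twoSidedIdeal {x : R} (k : K) (hx : x ∈ I) : k • x ∈ I := by
  rw [Algebra.smul_def]
  exact I.mul_mem_left _ _ hx

theorem p_mem_of_standard (hIJ : ∀ x ∈ I, F.IsStandard K x → x ∈ J) (hA : G.IsGenVertex A)
    (h : F.p A ∈ I) : F.p A ∈ J := by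
  rcases A.eq_empty_or_nonempty with rfl | hne
  · rw [F.p_empty]
    exact J.zero_mem
  · exact hIJ _ h (isStandard_p hA hne)

/-- Elements of the corner at `w` whose component in degree zero is `p_w`. -/
theorem corner_mem (hIJ : ∀ x ∈ I, F.IsStandard K x → x ∈ J) {n : ℕ} {S : Finset E} {y : R}
    (hy : y ∈ Submodule.span K
      {x | ∃ α, G.IsClosedPathAt α w ∧ α.length ≤ n ∧ x = F.sProd α * F.p {w}})
    (hz : (F.p {w} + y) * F.defect S ∈ I) : (F.p {w} + y) * F.defect S ∈ J := by
  have hcomm := F.p_commute_defect (.singleton w) S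
  have hyp : y * F.p {w} = y := by
    clear hz
    induction hy using Submodule.span_induction with
    | mem x hx =>
      obtain ⟨α, -, -, rfl⟩ := hx
      rw [mul_assoc, F.p_mul_self (.singleton w)]
    | zero => rw [zero_mul]
    | add x y _ _ hx hy => rw [add_mul, hx, hy]
    | smul k x _ hx => rw [smul_mul_assoc, hx]
  -- This shows the element as a left multiple of p_w q_S, so p_w ∈ `J` or p_w q_S ∈ `J` suffices.
  have hzp : (F.p {w} + y) * F.defect S = (F.p {w} + y) * (F.p {w} * F.defect S) := by
    rw [← mul_assoc, add_mul _ _ (F.p {w}), F.p_mul_self (.singleton w), hyp]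
  by_cases hex : ∃ c, G.IsFirstReturnAt c w ∧ ∀ e ∈ c.head?, e ∉ S
  · obtain ⟨c, hc, hcS⟩ := hex
    by_cases hu : ∀ b, G.IsFirstReturnAt b w → b = c
    · refine hIJ _ hz (isStandard_of_unique_cycle (hc.isCycleAt_of_unique hu)
        (fun d hd => hu d hd.isFirstReturnAt) S ?_)
      refine Submodule.span_mono ?_ hy
      rintro x ⟨α, hα, -, rfl⟩
      obtain ⟨r, rfl⟩ := eq_listPow_of_firstReturn_unique hu _ α le_rfl hα
      exact ⟨r, rfl⟩
    · push Not at hu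
      obtain ⟨d, hd, hdc⟩ := hu
      -- The exponent exceeds the length of every path in `y`, and it is positive even for `n = 0`,
      -- so `γ` begins with the first edge of `c`, which is outside `S`. Therefore q_S fixes s_γ,
      -- wherever `d` begins.
      set γ := listPow c (n + 1) ++ d with hγ
      have hγc : G.IsClosedPathAt γ w :=
        hc.toIsClosedPathAt.listPow_append hd.toIsClosedPathAt _
      have hqγ : F.defect S * F.sProd γ = F.sProd γ := by
        obtain ⟨e, l, rfl, -⟩ := hc.exists_cons
        rw [hγ, listPow_succ, List.cons_append, List.cons_append, sProd_cons, ← mul_assoc,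
          F.defect_mul_s_of_notMem (hcS e rfl)]
      have hpγ : F.p {w} * F.sProd γ = F.sProd γ :=
        F.p_mul_sProd_of_startsAt hγc.ne_nil hγc.startsAt
      have hkill : F.p {w} * F.tProd γ * y * F.sProd γ = 0 := by
        clear hz hzp hyp
        induction hy using Submodule.span_induction with
        | mem x hx =>
          obtain ⟨α, hα, hn, rfl⟩ := hx
          have := F.tProd_mul_sProd_eq_zero (w := w) (δ := α ++ γ) hγc.ne_nil (by simp)
            fun x hx => append_listPow_ne hc hd (Ne.symm hdc) hα (by omega) hx
          rw [sProd_append] at this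
          rw [mul_assoc _ (F.sProd α * _), mul_assoc (F.sProd α), hpγ, mul_assoc, this]
        | zero => simp
        | add x y _ _ hx hy => rw [mul_add, add_mul, hx, hy, add_zero]
        | smul k x _ hx => rw [mul_smul_comm, smul_mul_assoc, hx, smul_zero]
      have hpw : F.p {w} ∈ I := by
        have h := I.mul_mem_right _ (F.sProd γ * F.p {w})
          (I.mul_mem_left (F.p {w} * F.tProd γ) _ hz)
        have e : F.p {w} * F.tProd γ * ((F.p {w} + y) * F.defect S) * (F.sProd γ * F.p {w})
            = F.p {w} * (F.tProd γ * F.sProd γ) * F.p {w} := by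
          calc _ = F.p {w} * F.tProd γ * (F.p {w} + y) * (F.defect S * F.sProd γ) * F.p {w} := by
                simp only [mul_assoc]
            _ = (F.p {w} * F.tProd γ * (F.p {w} * F.sProd γ)
                + F.p {w} * F.tProd γ * y * F.sProd γ) * F.p {w} := by
                rw [hqγ, mul_add, add_mul]
                simp only [mul_assoc]
            _ = _ := by
                rw [hkill, add_zero, hpγ]
                simp only [mul_assoc]
        rwa [e, F.tProd_mul_sProd_self hγc] at h
      rw [hzp]
      exact J.mul_mem_left _ _
        (J.mul_mem_right _ _ (p_mem_of_standard hIJ (.singleton w) hpw))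
  -- Now every closed path at `w` begins with an edge of `S`, so q_S kills `y` from the left.
  · have hall : F.defect S * y = 0 := by
      clear hz hzp hyp
      induction hy using Submodule.span_induction with
      | mem x hx =>
        obtain ⟨α, hα, -, rfl⟩ := hx
        obtain ⟨b, x, rfl, hb, -⟩ := hα.exists_firstReturn
        obtain ⟨e, l, rfl, -⟩ := hb.exists_cons
        have he : e ∈ S := by
          by_contra he
          exact hex ⟨_, hb, fun f hf => by cases hf; exact he⟩
        rw [List.cons_append, sProd_cons, ← mul_assoc, ← mul_assoc, F.defect_mul_s_of_mem he,
          zero_mul, zero_mul]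
      | zero => simp
      | add x y _ _ hx hy => rw [mul_add, hx, hy, add_zero]
      | smul k x _ hx => rw [mul_smul_comm, hx, smul_zero]
    have h := I.mul_mem_left (F.defect S) _ hz
    rw [← mul_assoc, mul_add, hall, add_zero, ← hcomm, mul_assoc, F.defect_mul_self] at h
    rw [hzp]
    exact J.mul_mem_left _ _ (hIJ _ h (isStandard_p_mul_defect w S))

end LeavittFamily
end Ultragraph

/-! ### Induction on path length, then on ghost length. -/

namespace Ultragraph
namespace LeavittFamily

variable {V E R : Type*} {G : Ultragraph V E} [Ring R] (F : G.LeavittFamily R) {w : V}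
  {A B U : Set V} (K : Type*) [Field K] [Algebra K R]

/-- The span of the `s_α p_A` with `α` of length less than `n`. -/
def pathSpan (n : ℕ) : Submodule K R :=
  .span K {x | ∃ α A, G.IsGenVertex A ∧ α.length < n ∧ x = F.sProd α * F.p A}

/-- The span of the `s_α p_A` with `α` nonempty, of length at most `n`. -/
def nonemptyPathSpan (n : ℕ) : Submodule K R :=
  .span K {x | ∃ α A, G.IsGenVertex A ∧ α ≠ [] ∧ α.length ≤ n ∧ x = F.sProd α * F.p A}

/-- The span of the `s_α p_A s_β^*` with `β` of length at most `n`. -/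
def monomialSpan (n : ℕ) : Submodule K R :=
  .span K {x | ∃ α A β, G.IsGenVertex A ∧ β.length ≤ n ∧
    x = F.sProd α * F.p A * F.tProd β}

variable {F K}

theorem pathSpan_mono {m n : ℕ} (h : m ≤ n) : F.pathSpan K m ≤ F.pathSpan K n := by
  refine Submodule.span_mono ?_
  rintro x ⟨α, A, hA, hα, rfl⟩
  exact ⟨α, A, hA, hα.trans_le h, rfl⟩

theorem p_mul_nonemptyPathSpan (hB : G.IsGenVertex B) {n : ℕ} {u : R}
    (hu : u ∈ F.nonemptyPathSpan K n) : F.p B * u ∈ F.nonemptyPathSpan K n := by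
  induction hu using Submodule.span_induction with
  | mem x hx =>
    obtain ⟨_ | ⟨e, α⟩, A, hA, hα, hn, rfl⟩ := hx
    · exact absurd rfl hα
    · rw [sProd_cons, ← mul_assoc, ← mul_assoc]
      by_cases h : G.source e ∈ B
      · rw [F.p_mul_s_of_mem hB h, ← sProd_cons]
        exact Submodule.subset_span ⟨_, A, hA, hα, hn, rfl⟩
      · rw [F.p_mul_s_of_notMem hB h, zero_mul, zero_mul]
        exact Submodule.zero_mem _
  | zero => rw [mul_zero]; exact Submodule.zero_mem _
  | add x y _ _ hx hy => rw [mul_add]; exact Submodule.add_mem _ hx hy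
  | smul k x _ hx => rw [mul_smul_comm]; exact Submodule.smul_mem _ _ hx

theorem p_mul_sProd_mul_p_mem (hA : G.IsGenVertex A) (hB : G.IsGenVertex B) {n : ℕ} {α : List E}
    (hα : α.length < n) : F.p B * (F.sProd α * F.p A) ∈ F.pathSpan K n := by
  obtain _ | ⟨e, α⟩ := α
  · refine Submodule.subset_span ⟨[], B ∩ A, hB.inter hA, hα, ?_⟩
    simp [F.p_mul_p hB hA]
  · rw [sProd_cons, ← mul_assoc, ← mul_assoc]
    by_cases h : G.source e ∈ B
    · rw [F.p_mul_s_of_mem hB h, ← sProd_cons]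
      exact Submodule.subset_span ⟨_, A, hA, hα, rfl⟩
    · rw [F.p_mul_s_of_notMem hB h, zero_mul, zero_mul]
      exact Submodule.zero_mem _

theorem t_mul_nonemptyPathSpan (e : E) {n : ℕ} {u : R} (hu : u ∈ F.nonemptyPathSpan K n) :
    F.t e * u ∈ F.pathSpan K n := by
  induction hu using Submodule.span_induction with
  | mem x hx =>
    obtain ⟨_ | ⟨f, α⟩, A, hA, hα, hn, rfl⟩ := hx
    · exact absurd rfl hα
    · rw [sProd_cons, mul_assoc, ← mul_assoc]
      by_cases h : e = f
      · subst h
        rw [F.t_mul_s_self]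
        exact p_mul_sProd_mul_p_mem hA (.range e) hn
      · rw [F.t_mul_s_ne h, zero_mul]
        exact Submodule.zero_mem _
  | zero => rw [mul_zero]; exact Submodule.zero_mem _
  | add x y _ _ hx hy => rw [mul_add]; exact Submodule.add_mem _ hx hy
  | smul k x _ hx => rw [mul_smul_comm]; exact Submodule.smul_mem _ _ hx

/-- Take the first edges of the paths that occur. For such T, u = ∑_{e ∈ T} s_e s_e^* u, and no
relation at vertices is needed. Quantifying over larger sets makes the claim additive in `u`. -/
theorem exists_defect_mul_eq_zero {n : ℕ} {u : R} (hu : u ∈ F.nonemptyPathSpan K n) :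
    ∃ T : Finset E, ∀ T', T ⊆ T' → F.defect T' * u = 0 := by
  classical
  induction hu using Submodule.span_induction with
  | mem x hx =>
    obtain ⟨_ | ⟨f, α⟩, A, hA, hα, hn, rfl⟩ := hx
    · exact absurd rfl hα
    · refine ⟨{f}, fun T' h => ?_⟩
      rw [sProd_cons, ← mul_assoc, ← mul_assoc,
        F.defect_mul_s_of_mem (h (Finset.mem_singleton_self f)), zero_mul, zero_mul]
  | zero => exact ⟨∅, fun _ _ => mul_zero _⟩
  | add x y _ _ hx hy =>
    obtain ⟨T₁, h₁⟩ := hx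
    obtain ⟨T₂, h₂⟩ := hy
    refine ⟨T₁ ∪ T₂, fun T' h => ?_⟩
    rw [mul_add, h₁ T' (Finset.union_subset_left h), h₂ T' (Finset.union_subset_right h),
      add_zero]
  | smul k x _ hx =>
    obtain ⟨T, h⟩ := hx
    exact ⟨T, fun T' h' => by rw [mul_smul_comm, h T' h', smul_zero]⟩

/-- `B` is contained in or disjoint from every member of the list. -/
def Adapted (As : List (Set V)) (B : Set V) : Prop := ∀ A ∈ As, B ⊆ A ∨ Disjoint B A

theorem Adapted.of_append_left {As Bs : List (Set V)} (h : Adapted (As ++ Bs) B) :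
    Adapted As B := fun A hA => h A (List.mem_append_left _ hA)

theorem Adapted.of_append_right {As Bs : List (Set V)} (h : Adapted (As ++ Bs) B) :
    Adapted Bs B := fun A hA => h A (List.mem_append_right _ hA)

theorem eq_singleton_or_notMem {v : V} (h : B ⊆ {v} ∨ Disjoint B {v}) : B = {v} ∨ v ∉ B := by
  rcases h with h | h
  · rcases Set.subset_singleton_iff_eq.1 h with rfl | rfl
    · exact Or.inr (Set.notMem_empty v)
    · exact Or.inl rfl
  · exact Or.inr (Set.disjoint_singleton_right.1 h)

variable {I J : TwoSidedIdeal R}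

/-- Successive cuts by the members of the list write p_U as a sum of projections of adapted subsets.
-/
theorem mul_p_mem_of_adapted (z : R) (As : List (Set V)) (hAs : ∀ A ∈ As, G.IsGenVertex A) :
    ∀ U, G.IsGenVertex U →
      (∀ B, G.IsGenVertex B → B ⊆ U → Adapted As B → z * F.p B ∈ J) → z * F.p U ∈ J := by
  induction As with
  | nil => exact fun U hU h => h U hU subset_rfl (by simp [Adapted])
  | cons A As ih =>
    intro U hU h
    have hA := hAs A List.mem_cons_self
    have ih := ih fun B hB => hAs B (List.mem_cons_of_mem _ hB)
    rw [F.p_split hA hU, mul_add]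
    refine J.add_mem (ih _ (hU.inter hA) fun B hB hBU had => ?_)
      (ih _ (hU.sdiff hA) fun B hB hBU had => ?_)
    · exact h B hB (hBU.trans Set.inter_subset_left)
        (List.forall_mem_cons.2 ⟨Or.inl (hBU.trans Set.inter_subset_right), had⟩)
    · exact h B hB (hBU.trans Set.sdiff_subset)
        (List.forall_mem_cons.2 ⟨Or.inr (Set.disjoint_sdiff_left.mono_left hBU), had⟩)

theorem exists_mul_p_eq {n : ℕ} {y : R} (hy : y ∈ F.pathSpan K n) :
    ∃ U, G.IsGenVertex U ∧ y * F.p U = y := by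
  induction hy using Submodule.span_induction with
  | mem x hx =>
    obtain ⟨α, A, hA, -, rfl⟩ := hx
    exact ⟨A, hA, by rw [mul_assoc, F.p_mul_self hA]⟩
  | zero => exact ⟨∅, .empty, zero_mul _⟩
  | add x y _ _ hx hy =>
    obtain ⟨U₁, h₁, hx⟩ := hx
    obtain ⟨U₂, h₂, hy⟩ := hy
    refine ⟨U₁ ∪ U₂, h₁.union h₂, ?_⟩
    rw [add_mul]
    nth_rw 1 [← hx, ← hy]
    rw [mul_assoc, mul_assoc, F.p_mul_p h₁ (h₁.union h₂), F.p_mul_p h₂ (h₁.union h₂),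
      Set.inter_eq_left.2 Set.subset_union_left, Set.inter_eq_left.2 Set.subset_union_right, hx, hy]
  | smul k x _ hx =>
    obtain ⟨U, hU, hx⟩ := hx
    exact ⟨U, hU, by rw [smul_mul_assoc, hx]⟩

/-- On small enough generalized vertices, a combination of paths splits into a multiple of the
vertex projection and a combination of nonempty paths. -/
theorem exists_adapted_decomposition {n : ℕ} {y : R} (hy : y ∈ F.pathSpan K (n + 1)) :
    ∃ As : List (Set V), (∀ A ∈ As, G.IsGenVertex A) ∧ ∀ B, G.IsGenVertex B → Adapted As B →
      ∃ (k : K) (u : R), u ∈ F.nonemptyPathSpan K n ∧ y * F.p B = k • F.p B + u ∧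
        ((¬ ∃ w, B = {w}) → F.p B * u = 0) := by
  induction hy using Submodule.span_induction with
  | mem x hx =>
    obtain ⟨_ | ⟨e, α⟩, A, hA, hn, rfl⟩ := hx
    · refine ⟨[A], by simpa using hA, fun B hB had => ?_⟩
      rcases had A List.mem_cons_self with h | h
      · refine ⟨1, 0, Submodule.zero_mem _, ?_, fun _ => mul_zero _⟩
        rw [sProd_nil, one_mul, F.p_mul_p hA hB, Set.inter_eq_right.2 h, one_smul, add_zero]
      · refine ⟨0, 0, Submodule.zero_mem _, ?_, fun _ => mul_zero _⟩
        rw [sProd_nil, one_mul, F.p_mul_p hA hB, h.symm.inter_eq, F.p_empty, zero_smul, add_zero]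
    -- An adapted `B` is either {s(e)} itself or misses s(e), and then p_B kills the path.
    · refine ⟨[{G.source e}], by simpa using .singleton _, fun B hB had => ?_⟩
      refine ⟨0, F.sProd (e :: α) * F.p (A ∩ B), Submodule.subset_span
        ⟨_, _, hA.inter hB, by simp, Nat.lt_succ_iff.1 hn, rfl⟩, ?_, fun hB' => ?_⟩
      · rw [mul_assoc, F.p_mul_p hA hB, zero_smul, zero_add]
      · rcases eq_singleton_or_notMem (had _ List.mem_cons_self) with h | h
        · exact absurd ⟨_, h⟩ hB'
        · rw [sProd_cons, mul_assoc, ← mul_assoc, F.p_mul_s_of_notMem hB h, zero_mul]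
  | zero =>
    refine ⟨[], by simp, fun B _ _ => ⟨0, 0, Submodule.zero_mem _, by simp, by simp⟩⟩
  | add x y _ _ hx hy =>
    obtain ⟨As, hAs, hx⟩ := hx
    obtain ⟨Bs, hBs, hy⟩ := hy
    refine ⟨As ++ Bs, fun A hA => (List.mem_append.1 hA).elim (hAs A) (hBs A),
      fun B hB had => ?_⟩
    obtain ⟨k, u, hu, hxu, hpu⟩ := hx B hB had.of_append_left
    obtain ⟨l, v, hv, hyv, hpv⟩ := hy B hB had.of_append_right
    refine ⟨k + l, u + v, Submodule.add_mem _ hu hv, ?_, fun h => ?_⟩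
    · rw [add_mul, hxu, hyv, add_smul]
      abel
    · rw [mul_add, hpu h, hpv h, add_zero]
  | smul l x _ hx =>
    obtain ⟨As, hAs, hx⟩ := hx
    refine ⟨As, hAs, fun B hB had => ?_⟩
    obtain ⟨k, u, hu, hxu, hpu⟩ := hx B hB had
    refine ⟨l * k, l • u, Submodule.smul_mem _ _ hu, ?_, fun h => ?_⟩
    · rw [smul_mul_assoc, hxu, smul_add, mul_smul]
    · rw [mul_smul_comm, hpu h, smul_zero]

theorem corner_nonemptyPathSpan {n : ℕ} {u : R} (hu : u ∈ F.nonemptyPathSpan K n) :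
    F.p {w} * u * F.p {w} ∈ Submodule.span K
      {x | ∃ α, G.IsClosedPathAt α w ∧ α.length ≤ n ∧ x = F.sProd α * F.p {w}} := by
  induction hu using Submodule.span_induction with
  | mem x hx =>
    obtain ⟨α, A, hA, hα, hn, rfl⟩ := hx
    rw [← mul_assoc, mul_assoc, F.p_mul_p hA (.singleton w)]
    by_cases hw : w ∈ A
    · rw [Set.inter_eq_right.2 (Set.singleton_subset_iff.2 hw)]
      by_cases hc : G.IsClosedPathAt α w
      · rw [F.p_mul_sProd_of_startsAt hα hc.startsAt]
        exact Submodule.subset_span ⟨α, hc, hn, rfl⟩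
      · rw [F.corner_sProd_of_not_closed hα hc]
        exact Submodule.zero_mem _
    · rw [Set.inter_singleton_eq_empty.2 hw, F.p_empty, mul_zero]
      exact Submodule.zero_mem _
  | zero => rw [mul_zero, zero_mul]; exact Submodule.zero_mem _
  | add x y _ _ hx hy => rw [mul_add, add_mul]; exact Submodule.add_mem _ hx hy
  | smul k x _ hx =>
    rw [mul_smul_comm, smul_mul_assoc]
    exact Submodule.smul_mem _ _ hx

/-- Expand u = ∑ s_e (s_e^* u): each s_e^* u q_S stays in `I` and involves shorter paths, so the
induction hypothesis applies to it. -/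
theorem nonemptyPathSpan_mul_defect_mem {n : ℕ} {S : Finset E}
    (ih : ∀ y ∈ F.pathSpan K n, y * F.defect S ∈ I → y * F.defect S ∈ J) {u : R}
    (hu : u ∈ F.nonemptyPathSpan K n) (h : u * F.defect S ∈ I) : u * F.defect S ∈ J := by
  obtain ⟨T, hT⟩ := exists_defect_mul_eq_zero hu
  have h0 := hT T subset_rfl
  rw [defect, sub_mul, one_mul, sub_eq_zero, Finset.sum_mul] at h0
  rw [h0, Finset.sum_mul]
  refine sum_mem fun e _ => ?_
  rw [mul_assoc, mul_assoc]
  refine J.mul_mem_left _ _ ?_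
  rw [← mul_assoc]
  refine ih _ (t_mul_nonemptyPathSpan e hu) ?_
  rw [mul_assoc]
  exact I.mul_mem_left _ _ h

theorem pathSpan_mul_defect_mem (hIJ : ∀ x ∈ I, F.IsStandard K x → x ∈ J) (S : Finset E) (n : ℕ) :
    ∀ y ∈ F.pathSpan K n, y * F.defect S ∈ I → y * F.defect S ∈ J := by
  induction n with
  | zero =>
    intro y hy _
    have : F.pathSpan K 0 = ⊥ := by simp [pathSpan]
    rw [this, Submodule.mem_bot] at hy
    rw [hy, zero_mul]
    exact J.zero_mem
  | succ n ih =>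
    intro y hy h
    obtain ⟨U, hU, hyU⟩ := exists_mul_p_eq hy
    obtain ⟨As, hAs, hdec⟩ := exists_adapted_decomposition hy
    -- With p_U moved to the right end, it can be cut into adapted pieces. Adding the sources of `S`
    -- to the list makes every piece other than a singleton miss them, so that p_B q_S = p_B there.
    rw [← hyU, mul_assoc, F.p_commute_defect hU, ← mul_assoc]
    refine mul_p_mem_of_adapted _ (As ++ S.toList.map fun e => {G.source e}) ?_ U hU ?_
    · intro A hA
      rcases List.mem_append.1 hA with hA | hA
      · exact hAs A hA
      · obtain ⟨e, -, rfl⟩ := List.mem_map.1 hA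
        exact .singleton _
    intro B hB _ had
    have hI := I.mul_mem_right _ (F.p B) h
    rw [mul_assoc, ← F.p_commute_defect hB, ← mul_assoc] at hI ⊢
    obtain ⟨k, u, hu, hyu, hpu⟩ := hdec B hB had.of_append_left
    by_cases hk : k = 0
    · rw [hyu, hk, zero_smul, zero_add] at hI ⊢
      exact nonemptyPathSpan_mul_defect_mem ih hu hI
    have huB : u * F.p B = u := by
      have : u = y * F.p B - k • F.p B := by rw [hyu, add_sub_cancel_left]
      rw [this, sub_mul, mul_assoc, smul_mul_assoc, F.p_mul_self hB]
    have hpI : F.p B * (y * F.p B * F.defect S) ∈ I := I.mul_mem_left _ _ hI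
    have hpB : F.p B * (y * F.p B * F.defect S) = (k • F.p B + F.p B * u) * F.defect S := by
      rw [hyu, ← mul_assoc, mul_add, mul_smul_comm, F.p_mul_self hB]
    have hpJ : F.p B * (y * F.p B * F.defect S) ∈ J := by
      have hk' : F.p B * (y * F.p B * F.defect S) =
          k • ((F.p B + k⁻¹ • (F.p B * u * F.p B)) * F.defect S) := by
        rw [hpB, ← smul_mul_assoc, smul_add, smul_smul, mul_inv_cancel₀ hk, one_smul, mul_assoc, huB]
      have hI' := smul_mem_twoSidedIdeal k⁻¹ hpI
      rw [hk', smul_smul, inv_mul_cancel₀ hk, one_smul] at hI'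
      rw [hk']
      refine smul_mem_twoSidedIdeal k ?_
      by_cases hw : ∃ w, B = {w}
      · obtain ⟨w, rfl⟩ := hw
        exact corner_mem hIJ (Submodule.smul_mem _ _ (corner_nonemptyPathSpan hu)) hI'
      · have hS : F.p B * F.defect S = F.p B := by
          refine F.p_mul_defect_of_disjoint hB fun e he => ?_
          refine (eq_singleton_or_notMem (had.of_append_right _
            (List.mem_map.2 ⟨e, Finset.mem_toList.2 he, rfl⟩))).resolve_left fun h => hw ⟨_, h⟩
        rw [hpu hw, zero_mul, smul_zero, add_zero, hS] at hI' ⊢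
        exact p_mem_of_standard hIJ hB hI'
    -- Off the corner the scalar term cancels, which leaves only nonempty paths.
    have hrest : y * F.p B * F.defect S - F.p B * (y * F.p B * F.defect S) =
        (u - F.p B * u) * F.defect S := by
      rw [hpB, hyu, ← sub_mul, add_sub_add_left_eq_sub]
    have hrJ := nonemptyPathSpan_mul_defect_mem ih
      (Submodule.sub_mem _ hu (p_mul_nonemptyPathSpan hB hu)) (hrest ▸ I.sub_mem hI hpI)
    rw [← hrest] at hrJ
    simpa using J.add_mem hrJ hpJ

/-- If T contains the first edges of the ghost paths, q_T kills every monomial with a nontrivial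
ghost part, since s_e^* q_T = 0 for e ∈ T. -/
theorem exists_defect_eq_pathSpan {n : ℕ} {x : R} (hx : x ∈ F.monomialSpan K n) :
    ∃ T : Finset E, ∃ m, ∀ T', T ⊆ T' →
      ∃ y ∈ F.pathSpan K m, x * F.defect T' = y * F.defect T' := by
  classical
  induction hx using Submodule.span_induction with
  | mem x hx =>
    obtain ⟨α, A, _ | ⟨e, β⟩, hA, -, rfl⟩ := hx
    · refine ⟨∅, α.length + 1, fun T' _ => ⟨F.sProd α * F.p A, ?_, by simp⟩⟩
      exact Submodule.subset_span ⟨α, A, hA, Nat.lt_succ_self _, rfl⟩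
    · refine ⟨{e}, 0, fun T' h => ⟨0, Submodule.zero_mem _, ?_⟩⟩
      rw [tProd_cons, mul_assoc, mul_assoc, mul_assoc, F.t_mul_defect_of_mem
        (h (Finset.mem_singleton_self e)), mul_zero, mul_zero, mul_zero, zero_mul]
  | zero => exact ⟨∅, 0, fun _ _ => ⟨0, Submodule.zero_mem _, rfl⟩⟩
  | add x y _ _ hx hy =>
    obtain ⟨T₁, m₁, h₁⟩ := hx
    obtain ⟨T₂, m₂, h₂⟩ := hy
    refine ⟨T₁ ∪ T₂, max m₁ m₂, fun T' h => ?_⟩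
    obtain ⟨y₁, hy₁, e₁⟩ := h₁ T' (Finset.union_subset_left h)
    obtain ⟨y₂, hy₂, e₂⟩ := h₂ T' (Finset.union_subset_right h)
    exact ⟨y₁ + y₂, Submodule.add_mem _ (pathSpan_mono (le_max_left _ _) hy₁)
      (pathSpan_mono (le_max_right _ _) hy₂), by rw [add_mul, add_mul, e₁, e₂]⟩
  | smul k x _ hx =>
    obtain ⟨T, m, h⟩ := hx
    refine ⟨T, m, fun T' h' => ?_⟩
    obtain ⟨y, hy, e⟩ := h T' h'
    exact ⟨k • y, Submodule.smul_mem _ _ hy, by rw [smul_mul_assoc, smul_mul_assoc, e]⟩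

/-- The factor s_e cancels against the last ghost factor, or makes the product zero. Without a ghost
part it merely extends the path. -/
theorem monomialSpan_mul_s (e : E) {n : ℕ} {x : R} (hx : x ∈ F.monomialSpan K (n + 1)) :
    x * F.s e ∈ F.monomialSpan K n := by
  induction hx using Submodule.span_induction with
  | mem x hx =>
    obtain ⟨α, A, _ | ⟨f, β⟩, hA, hn, rfl⟩ := hx
    · rw [tProd_nil, mul_one, mul_assoc]
      by_cases h : G.source e ∈ A
      · rw [F.p_mul_s_of_mem hA h]
        refine Submodule.subset_span ⟨α ++ [e], G.range e, [], .range e, Nat.zero_le _, ?_⟩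
        simp [sProd_append, mul_assoc, F.s_range]
      · rw [F.p_mul_s_of_notMem hA h, mul_zero]
        exact Submodule.zero_mem _
    · rw [tProd_cons, mul_assoc, mul_assoc (F.tProd β)]
      by_cases h : f = e
      · subst h
        rw [F.t_mul_s_self]
        have hβ : β.length ≤ n := Nat.succ_le_succ_iff.1 hn
        obtain _ | ⟨g, β⟩ := β
        · refine Submodule.subset_span ⟨α, A ∩ G.range f, [], hA.inter (.range f), hβ, ?_⟩
          rw [tProd_nil, one_mul, mul_one, mul_assoc, F.p_mul_p hA (.range f)]
        · rw [tProd_cons, mul_assoc (F.tProd β)]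
          by_cases hg : G.source g ∈ G.range f
          · rw [F.t_mul_p_of_mem (.range f) hg, ← tProd_cons]
            exact Submodule.subset_span ⟨α, A, g :: β, hA, hβ, rfl⟩
          · rw [F.t_mul_p_of_notMem (.range f) hg, mul_zero, mul_zero]
            exact Submodule.zero_mem _
      · rw [F.t_mul_s_ne h, mul_zero, mul_zero]
        exact Submodule.zero_mem _
  | zero => rw [zero_mul]; exact Submodule.zero_mem _
  | add x y _ _ hx hy => rw [add_mul]; exact Submodule.add_mem _ hx hy
  | smul k x _ hx => rw [smul_mul_assoc]; exact Submodule.smul_mem _ _ hx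

/-- An ideal `J` that contains the standard elements of `I` contains all of `I`, as far as `I`
consists of combinations of monomials. -/
theorem mem_of_mem_monomialSpan (hIJ : ∀ x ∈ I, F.IsStandard K x → x ∈ J) (n : ℕ) :
    ∀ x ∈ F.monomialSpan K n, x ∈ I → x ∈ J := by
  have key : ∀ n, ∀ x ∈ F.monomialSpan K n, x ∈ I →
      (∀ e, x * F.s e ∈ I → x * F.s e ∈ J) → x ∈ J := by
    intro n x hx hI hs
    obtain ⟨T, m, h⟩ := exists_defect_eq_pathSpan hx
    obtain ⟨y, hy, hxy⟩ := h T subset_rfl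
    have hd : x * F.defect T ∈ J := by
      rw [hxy]
      refine pathSpan_mul_defect_mem hIJ T m y hy ?_
      rw [← hxy]
      exact I.mul_mem_right _ _ hI
    have hsum : x * ∑ e ∈ T, F.s e * F.t e ∈ J := by
      rw [Finset.mul_sum]
      refine sum_mem fun e _ => ?_
      rw [← mul_assoc]
      exact J.mul_mem_right _ _ (hs e (I.mul_mem_right _ _ hI))
    have := J.add_mem hd hsum
    rwa [defect, ← mul_add, sub_add_cancel, mul_one] at this
  induction n with
  | zero =>
    intro x hx hI
    have hp : ∃ m, x ∈ F.pathSpan K m := by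
      clear hI
      induction hx using Submodule.span_induction with
      | mem x hx =>
        obtain ⟨α, A, β, hA, hβ, rfl⟩ := hx
        obtain rfl := List.length_eq_zero_iff.1 (Nat.le_zero.1 hβ)
        exact ⟨α.length + 1, Submodule.subset_span ⟨α, A, hA, Nat.lt_succ_self _, by simp⟩⟩
      | zero => exact ⟨0, Submodule.zero_mem _⟩
      | add x y _ _ hx hy =>
        obtain ⟨m₁, h₁⟩ := hx
        obtain ⟨m₂, h₂⟩ := hy
        exact ⟨max m₁ m₂, Submodule.add_mem _ (pathSpan_mono (le_max_left _ _) h₁)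
          (pathSpan_mono (le_max_right _ _) h₂)⟩
      | smul k x _ hx => exact hx.imp fun m h => Submodule.smul_mem _ _ h
    obtain ⟨m, hm⟩ := hp
    have h1 : x * F.defect ∅ = x := by simp [defect]
    have := pathSpan_mul_defect_mem hIJ ∅ m x hm
    rw [h1] at this
    exact this hI
  | succ n ih => exact fun x hx hI => key _ x hx hI fun e => ih _ (monomialSpan_mul_s e hx)

end LeavittFamily
end Ultragraph

/-! ### Stability of the span of monomials under generators. -/

namespace Ultragraph
namespace LeavittFamily

variable {V E R : Type*} {G : Ultragraph V E} [Ring R] {F : G.LeavittFamily R}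
  {B : Set V} {K : Type*} [Field K] [Algebra K R]

theorem monomialSpan_mono {m n : ℕ} (h : m ≤ n) : F.monomialSpan K m ≤ F.monomialSpan K n := by
  refine Submodule.span_mono ?_
  rintro x ⟨α, A, β, hA, hβ, rfl⟩
  exact ⟨α, A, β, hA, hβ.trans h, rfl⟩

theorem p_mul_monomialSpan (hB : G.IsGenVertex B) {n : ℕ} {x : R}
    (hx : x ∈ F.monomialSpan K n) : F.p B * x ∈ F.monomialSpan K n := by
  induction hx using Submodule.span_induction with
  | mem x hx =>
    obtain ⟨_ | ⟨e, α⟩, A, β, hA, hn, rfl⟩ := hx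
    · refine Submodule.subset_span ⟨[], B ∩ A, β, hB.inter hA, hn, ?_⟩
      rw [sProd_nil, one_mul, one_mul, ← mul_assoc, F.p_mul_p hB hA]
    · rw [sProd_cons, ← mul_assoc, ← mul_assoc, ← mul_assoc]
      by_cases h : G.source e ∈ B
      · rw [F.p_mul_s_of_mem hB h, ← sProd_cons]
        exact Submodule.subset_span ⟨_, A, β, hA, hn, rfl⟩
      · rw [F.p_mul_s_of_notMem hB h, zero_mul, zero_mul, zero_mul]
        exact Submodule.zero_mem _
  | zero => rw [mul_zero]; exact Submodule.zero_mem _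
  | add x y _ _ hx hy => rw [mul_add]; exact Submodule.add_mem _ hx hy
  | smul k x _ hx => rw [mul_smul_comm]; exact Submodule.smul_mem _ _ hx

theorem s_mul_monomialSpan (e : E) {n : ℕ} {x : R} (hx : x ∈ F.monomialSpan K n) :
    F.s e * x ∈ F.monomialSpan K n := by
  induction hx using Submodule.span_induction with
  | mem x hx =>
    obtain ⟨α, A, β, hA, hn, rfl⟩ := hx
    rw [← mul_assoc, ← mul_assoc, ← sProd_cons]
    exact Submodule.subset_span ⟨_, A, β, hA, hn, rfl⟩
  | zero => rw [mul_zero]; exact Submodule.zero_mem _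
  | add x y _ _ hx hy => rw [mul_add]; exact Submodule.add_mem _ hx hy
  | smul k x _ hx => rw [mul_smul_comm]; exact Submodule.smul_mem _ _ hx

theorem t_mul_monomialSpan (e : E) {n : ℕ} {x : R} (hx : x ∈ F.monomialSpan K n) :
    F.t e * x ∈ F.monomialSpan K (n + 1) := by
  induction hx using Submodule.span_induction with
  | mem x hx =>
    obtain ⟨_ | ⟨f, α⟩, A, β, hA, hn, rfl⟩ := hx
    · rw [sProd_nil, one_mul, ← mul_assoc]
      by_cases h : G.source e ∈ A
      · rw [F.t_mul_p_of_mem hA h]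
        refine Submodule.subset_span ⟨[], G.range e, β ++ [e], .range e, by simpa using hn, ?_⟩
        rw [tProd_append, sProd_nil, one_mul, tProd_cons, tProd_nil, one_mul, ← mul_assoc,
          F.range_t]
      · rw [F.t_mul_p_of_notMem hA h, zero_mul]
        exact Submodule.zero_mem _
    · rw [sProd_cons, ← mul_assoc, ← mul_assoc, ← mul_assoc]
      by_cases h : e = f
      · subst h
        rw [F.t_mul_s_self, mul_assoc, mul_assoc, ← mul_assoc (F.sProd α)]
        exact p_mul_monomialSpan (.range e)
          (Submodule.subset_span ⟨_, A, β, hA, hn.trans n.le_succ, rfl⟩)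
      · rw [F.t_mul_s_ne h, zero_mul, zero_mul, zero_mul]
        exact Submodule.zero_mem _
  | zero => rw [mul_zero]; exact Submodule.zero_mem _
  | add x y _ _ hx hy => rw [mul_add]; exact Submodule.add_mem _ hx hy
  | smul k x _ hx => rw [mul_smul_comm]; exact Submodule.smul_mem _ _ hx

end LeavittFamily

/-! ### Transfer between the Leavitt path algebra and its unitization. -/

namespace LeavittPathAlgebra

variable {V E : Type*} {G : Ultragraph V E} {K : Type*} [Field K]

theorem induction_on_generators {P : G.LeavittPathAlgebra K → Prop} (hzero : P 0)
    (hadd : ∀ x y, P x → P y → P (x + y)) (hsmul : ∀ (k : K) x, P x → P (k • x))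
    (hgen : ∀ a, P (mk G K (G.gen K a))) (hmul : ∀ a y, P y → P (mk G K (G.gen K a) * y))
    (x : G.LeavittPathAlgebra K) : P x := by
  obtain ⟨a, rfl⟩ := mk_surjective x
  induction a using MonoidAlgebra.induction_linear with
  | zero => exact hzero
  | add a b ha hb => exact hadd _ _ ha hb
  | single w k =>
    have hw : P (mk G K (MonoidAlgebra.single w 1)) := by
      induction w using FreeSemigroup.recOnMul with
      | ih1 x => exact hgen x
      | ih2 x y _ hy =>
        have h := hmul x _ hy
        rwa [← mk_mul, gen, MonoidAlgebra.single_mul_single, one_mul] at h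
    have h := hsmul k _ hw
    rwa [← mk_smul, MonoidAlgebra.smul_single, smul_eq_mul, mul_one] at h

open Classical in
variable (G K) in
/-- The generators of the Leavitt path algebra inside its unitization. -/
noncomputable def unitizationFamily : G.LeavittFamily (Unitization K (G.LeavittPathAlgebra K)) where
  p A := if h : G.IsGenVertex A then Unitization.inr (p K ⟨A, h⟩) else 0
  s e := Unitization.inr (s G K e)
  t e := Unitization.inr (sStar G K e)
  p_empty := by
    rw [dif_pos .empty, ← Unitization.inr_zero]
    exact congrArg _ (mk_eq_iff.2 .p_empty)
  p_mul_p hA hB := by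
    rw [dif_pos hA, dif_pos hB, dif_pos (hA.inter hB), ← Unitization.inr_mul]
    exact congrArg _ (mk_eq_iff.2 (.p_inter hA hB))
  p_union hA hB := by
    rw [dif_pos hA, dif_pos hB, dif_pos (hA.inter hB), dif_pos (hA.union hB),
      ← Unitization.inr_add, ← Unitization.inr_sub]
    exact congrArg _ (mk_eq_iff.2 (.p_union hA hB))
  source_s e := by
    rw [dif_pos (.singleton _), ← Unitization.inr_mul]
    exact congrArg _ (mk_eq_iff.2 (.source_s e))
  s_range e := by
    rw [dif_pos (.range _), ← Unitization.inr_mul]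
    exact congrArg _ (mk_eq_iff.2 (.s_range e))
  range_t e := by
    rw [dif_pos (.range _), ← Unitization.inr_mul]
    exact congrArg _ (mk_eq_iff.2 (.range_sStar e))
  t_source e := by
    rw [dif_pos (.singleton _), ← Unitization.inr_mul]
    exact congrArg _ (mk_eq_iff.2 (.sStar_source e))
  t_mul_s_self e := by
    rw [dif_pos (.range _), ← Unitization.inr_mul]
    exact congrArg _ (mk_eq_iff.2 (.sStar_s_self e))
  t_mul_s_ne h := by
    rw [← Unitization.inr_mul, ← Unitization.inr_zero]
    exact congrArg _ (mk_eq_iff.2 (.sStar_s_ne h))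

theorem unitizationFamily_p (A : G.GenVertex) :
    (unitizationFamily G K).p A.1 = Unitization.inr (p K A) := dif_pos A.2

theorem unitizationFamily_s (e : E) :
    (unitizationFamily G K).s e = Unitization.inr (s G K e) := rfl

theorem unitizationFamily_t (e : E) :
    (unitizationFamily G K).t e = Unitization.inr (sStar G K e) := rfl

theorem unitizationFamily_sProd {c : List E} (hc : c ≠ []) :
    (unitizationFamily G K).sProd c = Unitization.inr (sPath G K c) := by
  induction c with
  | nil => exact absurd rfl hc
  | cons e c ih =>
    cases c with
    | nil => simp [unitizationFamily_s, sPath]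
    | cons f c =>
      rw [LeavittFamily.sProd_cons, ih (by simp), unitizationFamily_s, ← Unitization.inr_mul, sPath]

theorem inr_posPow (x : G.LeavittPathAlgebra K) (n : ℕ+) :
    (Unitization.inr (posPow x n) : Unitization K (G.LeavittPathAlgebra K)) =
      Unitization.inr x ^ (n : ℕ) := by
  induction n using PNat.recOn with
  | one => rw [posPow, PNat.recOn_one, PNat.one_coe, pow_one]
  | succ n ih =>
    rw [PNat.add_coe, PNat.one_coe, pow_succ, ← ih, ← Unitization.inr_mul, posPow, PNat.recOn_succ]
    rfl

theorem exists_mem_monomialSpan (x : G.LeavittPathAlgebra K) :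
    ∃ n, (Unitization.inr x : Unitization K _) ∈ (unitizationFamily G K).monomialSpan K n := by
  induction x using induction_on_generators with
  | hzero => exact ⟨0, by rw [Unitization.inr_zero]; exact Submodule.zero_mem _⟩
  | hadd x y hx hy =>
    obtain ⟨m, hx⟩ := hx
    obtain ⟨n, hy⟩ := hy
    refine ⟨max m n, ?_⟩
    rw [Unitization.inr_add]
    exact Submodule.add_mem _ (LeavittFamily.monomialSpan_mono (le_max_left _ _) hx)
      (LeavittFamily.monomialSpan_mono (le_max_right _ _) hy)
  | hsmul k x hx =>
    obtain ⟨n, hx⟩ := hx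
    exact ⟨n, by rw [Unitization.inr_smul]; exact Submodule.smul_mem _ _ hx⟩
  | hgen a =>
    rcases a with A | e | e
    · refine ⟨0, Submodule.subset_span ⟨[], A.1, [], A.2, le_rfl, ?_⟩⟩
      simp only [LeavittFamily.sProd_nil, LeavittFamily.tProd_nil, one_mul, mul_one,
        unitizationFamily_p]
      rfl
    · refine ⟨0, Submodule.subset_span ⟨[e], G.range e, [], .range e, le_rfl, ?_⟩⟩
      simp only [LeavittFamily.sProd_cons, LeavittFamily.sProd_nil, LeavittFamily.tProd_nil,
        mul_one, LeavittFamily.s_range]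
      rfl
    · refine ⟨1, Submodule.subset_span ⟨[], G.range e, [e], .range e, le_rfl, ?_⟩⟩
      simp only [LeavittFamily.sProd_nil, LeavittFamily.tProd_cons, LeavittFamily.tProd_nil,
        one_mul, LeavittFamily.range_t]
      rfl
  | hmul a y hy =>
    obtain ⟨n, hy⟩ := hy
    rcases a with A | e | e
    · refine ⟨n, ?_⟩
      have := LeavittFamily.p_mul_monomialSpan A.2 hy
      rwa [unitizationFamily_p, ← Unitization.inr_mul] at this
    · refine ⟨n, ?_⟩
      have := LeavittFamily.s_mul_monomialSpan e hy
      rwa [unitizationFamily_s, ← Unitization.inr_mul] at this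
    · refine ⟨n + 1, ?_⟩
      have := LeavittFamily.t_mul_monomialSpan e hy
      rwa [unitizationFamily_t, ← Unitization.inr_mul] at this

/-- Some p_A, with `A` large enough, acts as a left unit. This makes ring ideals stable under
scalars, hence ideals of the unitization. -/
theorem exists_left_unit (x : G.LeavittPathAlgebra K) :
    ∃ u : G.LeavittPathAlgebra K, u * x = x := by
  have key : ∃ A, G.IsGenVertex A ∧
      (unitizationFamily G K).p A * Unitization.inr x = Unitization.inr x := by
    set F := unitizationFamily G K
    have gen : ∀ a, ∃ A, G.IsGenVertex A ∧
        F.p A * Unitization.inr (mk G K (G.gen K a)) = Unitization.inr (mk G K (G.gen K a)) := by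
      rintro (A | e | e)
      · refine ⟨A.1, A.2, ?_⟩
        have := F.p_mul_self A.2
        rwa [unitizationFamily_p] at this ⊢
      · exact ⟨_, .singleton _, F.source_s e⟩
      · exact ⟨_, .range e, F.range_t e⟩
    induction x using induction_on_generators with
    | hzero => exact ⟨∅, .empty, by rw [Unitization.inr_zero, mul_zero]⟩
    | hadd x y hx hy =>
      obtain ⟨A, hA, hx⟩ := hx
      obtain ⟨B, hB, hy⟩ := hy
      refine ⟨A ∪ B, hA.union hB, ?_⟩
      rw [Unitization.inr_add, mul_add]
      nth_rw 1 [← hx, ← hy]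
      rw [← mul_assoc, ← mul_assoc, F.p_mul_p (hA.union hB) hA, F.p_mul_p (hA.union hB) hB,
        Set.inter_eq_right.2 Set.subset_union_left, Set.inter_eq_right.2 Set.subset_union_right,
        hx, hy]
    | hsmul k x hx =>
      obtain ⟨A, hA, hx⟩ := hx
      exact ⟨A, hA, by rw [Unitization.inr_smul, mul_smul_comm, hx]⟩
    | hgen a => exact gen a
    | hmul a y _ =>
      obtain ⟨A, hA, h⟩ := gen a
      exact ⟨A, hA, by rw [Unitization.inr_mul, ← mul_assoc, h]⟩
  obtain ⟨A, hA, h⟩ := key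
  refine ⟨p K ⟨A, hA⟩, Unitization.inr_injective (R := K) ?_⟩
  rw [Unitization.inr_mul]
  exact (congrArg (· * _) (unitizationFamily_p ⟨A, hA⟩)).symm.trans h

theorem smul_mem {I : TwoSidedIdeal (G.LeavittPathAlgebra K)} (k : K)
    {x : G.LeavittPathAlgebra K} (hx : x ∈ I) : k • x ∈ I := by
  obtain ⟨u, hu⟩ := exists_left_unit x
  rw [← hu, ← smul_mul_assoc]
  exact I.mul_mem_left _ _ hx

/-- An ideal of the Leavitt path algebra as an ideal of its unitization. -/
noncomputable def unitizationIdeal (I : TwoSidedIdeal (G.LeavittPathAlgebra K)) :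
    TwoSidedIdeal (Unitization K (G.LeavittPathAlgebra K)) :=
  .mk' (Unitization.inr '' (I : Set (G.LeavittPathAlgebra K)))
    ⟨0, I.zero_mem, Unitization.inr_zero K⟩
    (by
      rintro _ _ ⟨x, hx, rfl⟩ ⟨y, hy, rfl⟩
      exact ⟨x + y, I.add_mem hx hy, Unitization.inr_add K x y⟩)
    (by
      rintro _ ⟨x, hx, rfl⟩
      exact ⟨-x, I.neg_mem hx, Unitization.inr_neg K x⟩)
    (by
      rintro a _ ⟨x, hx, rfl⟩
      refine ⟨a.fst • x + a.snd * x, I.add_mem (smul_mem _ hx) (I.mul_mem_left _ _ hx), ?_⟩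
      ext <;> simp)
    (by
      rintro _ a ⟨x, hx, rfl⟩
      refine ⟨a.fst • x + x * a.snd, I.add_mem (smul_mem _ hx) (I.mul_mem_right _ _ hx), ?_⟩
      ext <;> simp)

theorem mem_unitizationIdeal {I : TwoSidedIdeal (G.LeavittPathAlgebra K)}
    {y : Unitization K (G.LeavittPathAlgebra K)} :
    y ∈ unitizationIdeal I ↔ y ∈ Unitization.inr '' (I : Set (G.LeavittPathAlgebra K)) :=
  TwoSidedIdeal.mem_mk' _ _ _ _ _ _ _

theorem inr_mem_unitizationIdeal {I : TwoSidedIdeal (G.LeavittPathAlgebra K)}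
    {x : G.LeavittPathAlgebra K} : Unitization.inr x ∈ unitizationIdeal I ↔ x ∈ I := by
  rw [mem_unitizationIdeal]
  exact Unitization.inr_injective.mem_set_image

theorem inr_sum {ι : Type*} (T : Finset ι) (f : ι → G.LeavittPathAlgebra K) :
    (Unitization.inr (∑ i ∈ T, f i) : Unitization K (G.LeavittPathAlgebra K)) =
      ∑ i ∈ T, Unitization.inr (f i) :=
  map_sum (Unitization.inrNonUnitalAlgHom K (G.LeavittPathAlgebra K)) f T

theorem isStandardGenerator_of_isStandard {x : G.LeavittPathAlgebra K}
    (h : (unitizationFamily G K).IsStandard K (Unitization.inr x)) :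
    G.IsStandardGenerator K x := by
  obtain ⟨A, v, S, m, k, r, c, hA, hv, hS, hc, hx⟩ := h
  refine ⟨⟨A, hA⟩, v, S, m, k, r, c, hv, hS, hc, Unitization.inr_injective (R := K) ?_⟩
  have hp : (unitizationFamily G K).p A = Unitization.inr (p K ⟨A, hA⟩) :=
    unitizationFamily_p ⟨A, hA⟩
  rw [hx, Unitization.inr_mul, Unitization.inr_add, Unitization.inr_sub, inr_sum, inr_sum, hp]
  congr 2
  swap
  · exact Finset.sum_congr rfl fun e _ => (Unitization.inr_mul K _ _).symm
  refine Finset.sum_congr rfl fun i _ => ?_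
  rw [Unitization.inr_smul, inr_posPow]
  -- At the empty list `sProd` is 1 while `sPath` is 0, so the two sides may differ there. A nonzero
  -- coefficient forces `c` to be a cycle, hence nonempty.
  by_cases hk : k i = 0
  · rw [hk, zero_smul, zero_smul]
  · rw [unitizationFamily_sProd (hc ⟨i, hk⟩).1.isClosedPathAt.ne_nil]

end LeavittPathAlgebra
end Ultragraph

theorem mainTheorem1 {V E K : Type*} [Countable V] [Countable E] [Field K]
    (G : Ultragraph V E) (I : TwoSidedIdeal (G.LeavittPathAlgebra K)) :
    ∃ X : Set (G.LeavittPathAlgebra K),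
      (∀ x ∈ X, x ∈ I ∧ G.IsStandardGenerator K x) ∧ TwoSidedIdeal.span X = I := by
  -- All standard elements of `I` are taken; `J` is then the image in the unitization of the ideal
  -- they generate.
  set X := {x | x ∈ I ∧ G.IsStandardGenerator K x}
  refine ⟨X, fun x hx => hx, le_antisymm (TwoSidedIdeal.span_le.2 fun x hx => hx.1) ?_⟩
  intro x hx
  obtain ⟨n, hn⟩ := Ultragraph.LeavittPathAlgebra.exists_mem_monomialSpan x
  refine Ultragraph.LeavittPathAlgebra.inr_mem_unitizationIdeal.1
    (Ultragraph.LeavittFamily.mem_of_mem_monomialSpan (K := K) ?_ n _ hn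
      (Ultragraph.LeavittPathAlgebra.inr_mem_unitizationIdeal.2 hx))
  intro y hy hstd
  obtain ⟨z, hz, rfl⟩ := Ultragraph.LeavittPathAlgebra.mem_unitizationIdeal.1 hy
  exact Ultragraph.LeavittPathAlgebra.inr_mem_unitizationIdeal.2 (TwoSidedIdeal.subset_span
    ⟨hz, Ultragraph.LeavittPathAlgebra.isStandardGenerator_of_isStandard hstd⟩)
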